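/- Let $s,k\ge 2$ and $n\ge ks$ be integers. A set $S\subseteq\{1,\dots,n\}$ is $s$-stable if $s\le|i-j|\le n-s$ for all distinct $i,j\in S$. Let $G=\mathrm{KG}(n,k)_{s\text{-stab}}$ be the graph whose vertices are the $s$-stable $k$-element subsets of $\{1,\dots,n\}$, two of them being adjacent when they are disjoint. A shift of $G$ is an automorphism $\phi$ of $G$ such that $\phi(v)$ is adjacent to $v$ for every vertex $v$. Every rotation and every reflection of the $n$-cycle $1,2,\dots,n$ acts on $G$ as an automorphism, by $\alpha(\{i_1,\dots,i_k\})=\{\alpha(i_1),\dots,\alpha(i_k)\}$; let $\sigma$ be the automorphism given by the rotation $x\mapsto x+1$ modulo $n$. (i) If $n\ge ks+1$, then no reflection of the $n$-cycle acts as a shift of $G$. (ii) If $n\ge (k+1)s-1$, then the shifts of $G$ are exactly the rotations $\sigma^i$ with $i\in\{1,\dots,s-1\}\cup\{n-s+1,\dots,n-1\}$, and $G$ has exactly $2(s-1)$ shifts. -/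

import Mathlib

/-- The Kneser graph: vertices are the `k`-subsets of an `n`-element set, and two vertices are
adjacent when they are disjoint (the first condition only matters when `k = 0`).
The ground set `{1, …, n}` is represented by `Fin n`, that is, every label is lowered by one. -/
def kneserGraph (n k : ℕ) : SimpleGraph {S : Finset (Fin n) // S.card = k} where
  Adj u v := u ≠ v ∧ Disjoint u.1 v.1
  symm := ⟨fun _ _ h => ⟨h.1.symm, h.2.symm⟩⟩
  loopless := ⟨fun _ h => h.1 rfl⟩

/-- `S` is `s`-stable: distinct elements are at distance at least `s` on the `n`-cycle. -/
def IsStableSet {n : ℕ} (s : ℕ) (S : Finset (Fin n)) : Prop :=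
  ∀ i ∈ S, ∀ j ∈ S, i ≠ j →
    (s : ℤ) ≤ |((i : ℕ) : ℤ) - ((j : ℕ) : ℤ)| ∧
      |((i : ℕ) : ℤ) - ((j : ℕ) : ℤ)| ≤ (n : ℤ) - (s : ℤ)

/-- The set of `s`-stable vertices of the Kneser graph. -/
def stableVertices (n k s : ℕ) : Set {S : Finset (Fin n) // S.card = k} :=
  {v | IsStableSet s v.1}

/-- The `s`-stable Kneser graph: the subgraph of the Kneser graph induced by the `s`-stable
vertices. -/
def stableKneserGraph (n k s : ℕ) : SimpleGraph (stableVertices n k s) :=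
  (kneserGraph n k).induce (stableVertices n k s)

/-- An automorphism of a graph is a shift if it maps every vertex to one of its neighbours. -/
def IsShift {V : Type*} {G : SimpleGraph V} (φ : G ≃g G) : Prop :=
  ∀ u : V, G.Adj u (φ u)

/-- The permutation `τ` of the ground set maps `s`-stable sets to `s`-stable sets, and so does
its inverse. -/
def PreservesStable {n : ℕ} (s : ℕ) (τ : Equiv.Perm (Fin n)) : Prop :=
  ∀ S : Finset (Fin n), IsStableSet s (S.map τ.toEmbedding) ↔ IsStableSet s S

/-- The automorphism `{i₁, …, i_k} ↦ {τ i₁, …, τ i_k}` of the `s`-stable Kneser graph given by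
a permutation `τ` of the ground set that preserves `s`-stability. -/
def inducedAut {n : ℕ} (k : ℕ) {s : ℕ} (τ : Equiv.Perm (Fin n)) (hτ : PreservesStable s τ) :
    stableKneserGraph n k s ≃g stableKneserGraph n k s where
  toFun v := ⟨⟨v.1.1.map τ.toEmbedding, by rw [Finset.card_map]; exact v.1.2⟩,
    (hτ v.1.1).mpr v.2⟩
  invFun v := ⟨⟨v.1.1.map τ.symm.toEmbedding, by rw [Finset.card_map]; exact v.1.2⟩,
    (hτ _).mp (by
      have h : (v.1.1.map τ.symm.toEmbedding).map τ.toEmbedding = v.1.1 := by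
        ext x; simp
      rw [h]; exact v.2)⟩
  left_inv v := by
    apply Subtype.ext; apply Subtype.ext; ext x; simp
  right_inv v := by
    apply Subtype.ext; apply Subtype.ext; ext x; simp
  map_rel_iff' := by
    rintro ⟨⟨S, hS⟩, hS'⟩ ⟨⟨T, hT⟩, hT'⟩
    simp [stableKneserGraph, kneserGraph]

/-- If `τ` preserves the relation "at distance at least `s` on the `n`-cycle", then it preserves
`s`-stability. -/
theorem preservesStable_of_dist {n s : ℕ} {τ : Equiv.Perm (Fin n)}
    (h : ∀ i j : Fin n, i ≠ j →
      (((s : ℤ) ≤ |((τ i : ℕ) : ℤ) - ((τ j : ℕ) : ℤ)| ∧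
        |((τ i : ℕ) : ℤ) - ((τ j : ℕ) : ℤ)| ≤ (n : ℤ) - (s : ℤ)) ↔
      ((s : ℤ) ≤ |((i : ℕ) : ℤ) - ((j : ℕ) : ℤ)| ∧
        |((i : ℕ) : ℤ) - ((j : ℕ) : ℤ)| ≤ (n : ℤ) - (s : ℤ)))) :
    PreservesStable s τ := by
  intro S
  constructor
  · intro hS i hi j hj hij
    exact (h i j hij).mp (hS (τ i) (by simpa using hi) (τ j) (by simpa using hj)
      (fun e => hij (τ.injective e)))
  · intro hS i' hi' j' hj' hij
    obtain ⟨i, hi, rfl⟩ := Finset.mem_map.mp hi'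
    obtain ⟨j, hj, rfl⟩ := Finset.mem_map.mp hj'
    have hne : i ≠ j := fun e => hij (by rw [e])
    exact (h i j hne).mpr (hS i hi j hj hne)

theorem preservesStable_finRotate (n s : ℕ) : PreservesStable s (finRotate n) := by
  apply preservesStable_of_dist
  intro i j hij
  cases n with
  | zero => exact i.elim0
  | succ m =>
    have hi := i.isLt
    have hj := j.isLt
    have hne : (i : ℕ) ≠ (j : ℕ) := fun e => hij (Fin.ext e)
    rw [coe_finRotate, coe_finRotate]
    simp only [Fin.ext_iff, Fin.val_last]
    split_ifs <;> grind

theorem PreservesStable.mul {n s : ℕ} {τ₁ τ₂ : Equiv.Perm (Fin n)}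
    (h₁ : PreservesStable s τ₁) (h₂ : PreservesStable s τ₂) : PreservesStable s (τ₁ * τ₂) := by
  intro S
  have h : S.map (τ₁ * τ₂).toEmbedding = (S.map τ₂.toEmbedding).map τ₁.toEmbedding := by
    rw [Finset.map_map]; rfl
  rw [h, h₁, h₂]

theorem preservesStable_finRotate_pow (n s i : ℕ) : PreservesStable s (finRotate n ^ i) := by
  induction i with
  | zero =>
    intro S
    have h : S.map (finRotate n ^ 0).toEmbedding = S := by
      rw [pow_zero]; exact Finset.map_refl
    rw [h]
  | succ i ih => rw [pow_succ]; exact ih.mul (preservesStable_finRotate n s)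

theorem preservesStable_revPerm (n s : ℕ) :
    PreservesStable s (Fin.revPerm : Equiv.Perm (Fin n)) := by
  apply preservesStable_of_dist
  intro i j hij
  have hi := i.isLt
  have hj := j.isLt
  simp only [Fin.revPerm_apply, Fin.val_rev]
  grind

/-- The rotation `σ^i`, where `σ` is the circular permutation of the ground set
(`x ↦ x + 1` modulo `n`), as an automorphism of the `s`-stable Kneser graph. -/
def rotationAut (n k s i : ℕ) : stableKneserGraph n k s ≃g stableKneserGraph n k s :=
  inducedAut k (finRotate n ^ i) (preservesStable_finRotate_pow n s i)

/-- The reflection `x ↦ i - 1 - x` modulo `n` of the ground set (written as `σ^i` after the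
reversal `x ↦ n - 1 - x` of `Fin n`), as an automorphism of the `s`-stable Kneser graph.
For `i` ranging over the integers modulo `n` these are all the reflections of the `n`-cycle. -/
def reflectionAut (n k s i : ℕ) : stableKneserGraph n k s ≃g stableKneserGraph n k s :=
  inducedAut k (finRotate n ^ i * Fin.revPerm)
    ((preservesStable_finRotate_pow n s i).mul (preservesStable_revPerm n s))

/-!
Write `v` for an `s`-stable `k`-set on the `n`-cycle and say that `u` arises from `v` by a *move* if
one element of `v` is replaced by a point at distance less than `s` from it. The classification of
the shifts rests on the fact that automorphisms are dihedral, which is proved by reading moves, then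
points, then the cycle off the graph.

*Moves.* Two vertices `v`, `u` differ by a move exactly when they are distinct, not adjacent, and no
third vertex is adjacent to all their common neighbours (`move_iff`). If `v` and `u` differ by a
move, every point outside `v ∪ u` lies on a common neighbour (`MoveAt.exists_vertex`), and
`v ∪ u` contains no third vertex. Conversely, list `v` and `u` in increasing order from a common
point: termwise minima, and sequences that switch from one list to the other, are vertices inside
`v ∪ u`, so the lists differ in one place (`move_of_subset`). Hence automorphisms preserve moves.

*Points.* In a 4-cycle of moves without diagonals opposite sides carry the same move
(`square_moveAt`). All moves `a → a + 1` are connected by such squares, so an automorphism `φ` sends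
them all to moves `x → y` with the same `x` and `y` (`exists_label`). If `n ≥ ks + 2`, the images of
`a → a + 1` and `a + 1 → a + 2` fit together (`exists_pointMap`): for `v` containing `a`, the
rotation `v + 1` avoids the position of the moving element before and after the two steps but not
in between, which could not happen for moves of two different elements. This defines a map of the
points, a permutation since `φ⁻¹` has one too (`exists_pointPerm`), and this permutation induces `φ`
(`mem_of_pointPerm`).

*The cycle.* When `n ≥ (k + 1)s - 1`, the permutation preserves the relation of being at distance
less than `s`. The points near to `x` but far from a point at distance `d < s` number `d`, so the
permutation preserves neighbours on the cycle and is a rotation or a reflection (`perm_dihedral`).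

*Shifts.* A reflection is never a shift, because it interchanges two points at distance `s` or
`s + 1`, and these lie on a common vertex (`not_isShift_reflectionAut`). A rotation by `i` is a
shift if and only if no vertex contains two points at distance `i`. Under the assumption
`n ≥ (k + 1)s - 1` this holds only when the points `0` and `i` are distinct and at distance less
than `s`.

The only case with `n ≥ (k + 1)s - 1` and `n < ks + 2` is `s = 2`, `n = 2k + 1`. Then the graph is
an odd cycle, and the shifts are found directly (`exists_rotation_of_odd`).
-/

/-! ### Points of the cycle -/

/-- The point of the `n`-cycle with integer coordinate `a`, read modulo `n`. -/
def pt (n : ℕ) [NeZero n] (a : ℤ) : Fin n :=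
  ⟨(a % (n : ℤ)).toNat, by
    have h0 : (0 : ℤ) < n := by exact_mod_cast Nat.pos_of_neZero n
    have h1 := Int.emod_nonneg a h0.ne'
    have h2 := Int.emod_lt_of_pos a h0
    omega⟩

/-- Two points of the `n`-cycle are far if their distance on the cycle is at least `s`. -/
def Far {n : ℕ} (s : ℕ) (i j : Fin n) : Prop :=
  (s : ℤ) ≤ |((i : ℕ) : ℤ) - ((j : ℕ) : ℤ)| ∧
    |((i : ℕ) : ℤ) - ((j : ℕ) : ℤ)| ≤ (n : ℤ) - (s : ℤ)

theorem Far.symm {n s : ℕ} {i j : Fin n} (h : Far s i j) : Far s j i := by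
  unfold Far at *
  rwa [abs_sub_comm]

section Points

variable {n : ℕ} [NeZero n]

theorem n_pos_int : (0 : ℤ) < n := by exact_mod_cast Nat.pos_of_neZero n

theorem pt_val (a : ℤ) : (((pt n a : Fin n) : ℕ) : ℤ) = a % (n : ℤ) := by
  have h1 := Int.emod_nonneg a (n_pos_int (n := n)).ne'
  simp only [pt]
  omega

theorem pt_eq_iff {a b : ℤ} : pt n a = pt n b ↔ a % (n : ℤ) = b % (n : ℤ) := by
  rw [← pt_val, ← pt_val, Fin.ext_iff]
  omega

theorem pt_coe (i : Fin n) : pt n ((i : ℕ) : ℤ) = i := by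
  have h := pt_val (n := n) ((i : ℕ) : ℤ)
  rw [Int.emod_eq_of_lt (by omega) (by exact_mod_cast i.isLt)] at h
  exact Fin.ext (by exact_mod_cast h)

@[simp] theorem pt_add_n (a : ℤ) : pt n (a + n) = pt n a := by
  rw [pt_eq_iff]; simp

theorem pt_add_congr {a b : ℤ} (h : pt n a = pt n b) (c : ℤ) : pt n (a + c) = pt n (b + c) := by
  rw [pt_eq_iff] at *
  exact Int.ModEq.add_right c h

theorem pt_sub_congr {a b : ℤ} (h : pt n a = pt n b) (c : ℤ) : pt n (c - a) = pt n (c - b) := by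
  rw [pt_eq_iff] at *
  exact Int.ModEq.sub_left c h

theorem pt_injOn {a b : ℤ} (h : pt n a = pt n b) (h1 : a < b + n) (h2 : b < a + n) : a = b := by
  rw [pt_eq_iff] at h
  obtain ⟨c, hc⟩ := Int.ModEq.dvd h
  have h0 := n_pos_int (n := n)
  have h3 : c < 1 := by by_contra hh; push Not at hh; nlinarith
  have h4 : -1 < c := by by_contra hh; push Not at hh; nlinarith
  have : c = 0 := by omega
  subst this
  linarith

theorem exists_pt (a : ℤ) (z : Fin n) : ∃ b, a ≤ b ∧ b < a + n ∧ pt n b = z := by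
  have h0 := n_pos_int (n := n)
  refine ⟨a + (((z : ℕ) : ℤ) - a) % n, ?_, ?_, ?_⟩
  · have := Int.emod_nonneg (((z : ℕ) : ℤ) - a) h0.ne'
    omega
  · have := Int.emod_lt_of_pos (((z : ℕ) : ℤ) - a) h0
    omega
  · conv_rhs => rw [← pt_coe z]
    rw [pt_eq_iff]
    simp

theorem emod_cases {a b : ℤ} (h1 : a ≤ b) (h2 : b ≤ a + n) :
    (b % (n : ℤ) = a % (n : ℤ) + (b - a)) ∨ (b % (n : ℤ) = a % (n : ℤ) + (b - a) - n) := by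
  have h0 := n_pos_int (n := n)
  have ha := Int.emod_nonneg a h0.ne'
  have ha' := Int.emod_lt_of_pos a h0
  have hb := Int.emod_nonneg b h0.ne'
  have hb' := Int.emod_lt_of_pos b h0
  have e : b % (n : ℤ) = (a % n + (b - a)) % n := by simp
  by_cases h : a % n + (b - a) < n
  · left
    rw [e, Int.emod_eq_of_lt (by omega) h]
  · by_cases h' : a % n + (b - a) < 2 * n
    · right
      rw [e, ← Int.sub_emod_right, Int.emod_eq_of_lt (by omega) (by omega)]
    · omega

theorem far_pt {s : ℕ} {a b : ℤ} (h1 : a ≤ b) (h2 : b ≤ a + n) :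
    Far s (pt n a) (pt n b) ↔ (a + s ≤ b ∧ b + s ≤ a + n) := by
  have h0 := n_pos_int (n := n)
  have hb := Int.emod_nonneg b h0.ne'
  have hb' := Int.emod_lt_of_pos b h0
  have ha := Int.emod_nonneg a h0.ne'
  have ha' := Int.emod_lt_of_pos a h0
  unfold Far
  rw [pt_val, pt_val]
  rcases emod_cases (n := n) h1 h2 with h | h <;> rw [h] at hb hb' ⊢ <;>
    rcases abs_cases (a % (n : ℤ) - (a % (n : ℤ) + (b - a))) with ⟨e, _⟩ | ⟨e, _⟩ <;>
    rcases abs_cases (a % (n : ℤ) - (a % (n : ℤ) + (b - a) - n)) with ⟨e', _⟩ | ⟨e', _⟩ <;>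
    simp only [e, e'] <;> omega

theorem finRotate_pt (a : ℤ) : finRotate n (pt n a) = pt n (a + 1) := by
  obtain ⟨m, rfl⟩ : ∃ m, n = m + 1 := Nat.exists_eq_succ_of_ne_zero (NeZero.ne n)
  have h0 := n_pos_int (n := m + 1)
  have ha := Int.emod_nonneg a h0.ne'
  have ha' := Int.emod_lt_of_pos a h0
  have hb := Int.emod_nonneg (a + 1) h0.ne'
  have hb' := Int.emod_lt_of_pos (a + 1) h0
  have hc := emod_cases (n := m + 1) (a := a) (b := a + 1) (by omega) (by omega)
  have e1 := pt_val (n := m + 1) a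
  have e2 := pt_val (n := m + 1) (a + 1)
  apply Fin.ext
  rw [coe_finRotate]
  simp only [Fin.ext_iff, Fin.val_last]
  split_ifs <;> push_cast at * <;> omega

theorem finRotate_pow_pt (i : ℕ) (a : ℤ) : (finRotate n ^ i) (pt n a) = pt n (a + i) := by
  induction i generalizing a with
  | zero => simp
  | succ i ih =>
    rw [pow_succ, Equiv.Perm.mul_apply, finRotate_pt, ih]
    congr 1; push_cast; ring

theorem rev_pt (a : ℤ) : Fin.rev (pt n a) = pt n (-1 - a) := by
  have h : ((Fin.rev (pt n a) : ℕ) : ℤ) = -1 - ((pt n a : ℕ) : ℤ) + n := by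
    have := (pt n a).isLt
    rw [Fin.val_rev]; omega
  rw [← pt_coe (Fin.rev (pt n a)), h, pt_add_n]
  exact pt_sub_congr (pt_coe _) _

end Points

/-! ### Stable sets as integer sequences -/

/-- The first `k` terms of `f`, read modulo `n`, run once around the `n`-cycle in increasing
order with consecutive gaps at least `s`. -/
def Adm (n k s : ℕ) (f : ℕ → ℤ) : Prop :=
  ∀ i j, i < j → j < k → f i + s ≤ f j ∧ f j + s ≤ f i + n

/-- The type of vertices of the stable Kneser graph. -/
abbrev Vertex (n k s : ℕ) : Type := ↥(stableVertices n k s)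

section Vertices

variable {n k s : ℕ}

theorem Vertex.ext {v w : Vertex n k s} (h : v.1.1 = w.1.1) : v = w :=
  Subtype.ext (Subtype.ext h)

theorem Vertex.far (v : Vertex n k s) {x y : Fin n} (hx : x ∈ v.1.1) (hy : y ∈ v.1.1)
    (h : x ≠ y) : Far s x y := v.2 x hx y hy h

theorem Vertex.eq_of_subset {v w : Vertex n k s} (h : v.1.1 ⊆ w.1.1) : v = w :=
  Vertex.ext (Finset.eq_of_subset_of_card_le h (by rw [v.1.2, w.1.2]))

/-- The vertex with a given underlying set. -/
def mkVertex (S : Finset (Fin n)) (hc : S.card = k)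
    (hS : ∀ x ∈ S, ∀ y ∈ S, x ≠ y → Far s x y) : Vertex n k s :=
  ⟨⟨S, hc⟩, hS⟩

theorem adj_iff (hk : 1 ≤ k) (u v : Vertex n k s) :
    (stableKneserGraph n k s).Adj u v ↔ Disjoint u.1.1 v.1.1 := by
  constructor
  · intro h; exact h.2
  · intro h
    refine ⟨fun e => ?_, h⟩
    have e' : u.1 = v.1 := e
    rw [e', disjoint_self] at h
    have := v.1.2
    rw [h] at this
    simp at this
    omega

variable [NeZero n]

theorem Adm.injOn (hs : 1 ≤ s) {f : ℕ → ℤ} (h : Adm n k s f) {i j : ℕ} (hi : i < k) (hj : j < k)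
    (e : pt n (f i) = pt n (f j)) : i = j := by
  rcases lt_trichotomy i j with hij | hij | hij
  · have := h i j hij hj
    have := pt_injOn e (by omega) (by omega)
    omega
  · exact hij
  · have := h j i hij hi
    have := pt_injOn e (by omega) (by omega)
    omega

/-- The vertex formed by the first `k` terms of an admissible sequence. -/
def ofSeq (hs : 1 ≤ s) (f : ℕ → ℤ) (h : Adm n k s f) : Vertex n k s :=
  mkVertex ((Finset.range k).image fun i => pt n (f i))
    (by
      rw [Finset.card_image_of_injOn, Finset.card_range]
      intro i hi j hj e
      exact h.injOn hs (by simpa using hi) (by simpa using hj) e)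
    (by
      intro x hx y hy hxy
      simp only [Finset.mem_image, Finset.mem_range] at hx hy
      obtain ⟨i, hi, rfl⟩ := hx
      obtain ⟨j, hj, rfl⟩ := hy
      rcases lt_trichotomy i j with hij | hij | hij
      · have := h i j hij hj
        exact (far_pt (by omega) (by omega)).2 this
      · subst hij; exact absurd rfl hxy
      · have := h j i hij hi
        exact ((far_pt (by omega) (by omega)).2 this).symm)

theorem mem_ofSeq {hs : 1 ≤ s} {f : ℕ → ℤ} {h : Adm n k s f} {z : Fin n} :
    z ∈ (ofSeq hs f h).1.1 ↔ ∃ i < k, pt n (f i) = z := by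
  simp [ofSeq, mkVertex]

/-- Every vertex through the point `a` is listed by an admissible sequence starting at `a`. -/
theorem exists_ofSeq (hs : 1 ≤ s) (v : Vertex n k s) {a : ℤ} (ha : pt n a ∈ v.1.1) :
    ∃ (f : ℕ → ℤ) (h : Adm n k s f), f 0 = a ∧ v = ofSeq hs f h := by
  classical
  have h0 := n_pos_int (n := n)
  set C : Finset ℤ := (Finset.Ico a (a + n)).filter fun c => pt n c ∈ v.1.1 with hC
  have hmem : ∀ c, c ∈ C ↔ (a ≤ c ∧ c < a + n) ∧ pt n c ∈ v.1.1 := by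
    intro c; simp [hC]
  have himg : C.image (pt n) = v.1.1 := by
    ext z
    simp only [Finset.mem_image, hmem]
    constructor
    · rintro ⟨c, ⟨_, hc⟩, rfl⟩; exact hc
    · intro hz
      obtain ⟨b, h1, h2, rfl⟩ := exists_pt a z
      exact ⟨b, ⟨⟨h1, h2⟩, hz⟩, rfl⟩
  have hcard : C.card = k := by
    rw [← v.1.2, ← himg, Finset.card_image_of_injOn]
    intro c hc d hd e
    have hc := (hmem c).1 hc
    have hd := (hmem d).1 hd
    exact pt_injOn e (by omega) (by omega)
  set g := C.orderEmbOfFin hcard with hg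
  have hgm : ∀ i, g i ∈ C := fun i => Finset.orderEmbOfFin_mem C hcard i
  set f : ℕ → ℤ := fun i => if hi : i < k then g ⟨i, hi⟩ else 0 with hf
  have hfi : ∀ i (hi : i < k), f i = g ⟨i, hi⟩ := fun i hi => by simp [hf, hi]
  have hadm : Adm n k s f := by
    intro i j hij hj
    rw [hfi i (by omega), hfi j hj]
    have hlt : g ⟨i, by omega⟩ < g ⟨j, hj⟩ := g.strictMono (by simpa using hij)
    have h1 := (hmem _).1 (hgm ⟨i, by omega⟩)
    have h2 := (hmem _).1 (hgm ⟨j, hj⟩)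
    refine (far_pt (by omega) (by omega)).1 (v.far h1.2 h2.2 fun e => ?_)
    have := pt_injOn e (by omega) (by omega)
    omega
  have hk : 0 < k := by
    rw [← v.1.2]; exact Finset.card_pos.2 ⟨_, ha⟩
  refine ⟨f, hadm, ?_, ?_⟩
  · rw [hfi 0 hk, hg, Finset.orderEmbOfFin_zero hcard hk]
    apply le_antisymm
    · exact Finset.min'_le _ _ ((hmem a).2 ⟨by omega, ha⟩)
    · exact ((hmem _).1 (Finset.min'_mem C _)).1.1
  · symm
    apply Vertex.eq_of_subset
    intro z hz
    obtain ⟨i, hi, rfl⟩ := mem_ofSeq.1 hz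
    rw [hfi i hi]
    exact ((hmem _).1 (hgm _)).2

theorem ofSeq_inj {hs : 1 ≤ s} {f g : ℕ → ℤ} {hf : Adm n k s f} {hg : Adm n k s g}
    (h0 : f 0 = g 0) (e : ofSeq hs f hf = ofSeq hs g hg) {i : ℕ} (hi : i < k) : f i = g i := by
  have key : ∀ {f g : ℕ → ℤ} {hf : Adm n k s f} {hg : Adm n k s g}, f 0 = g 0 →
      ofSeq hs f hf = ofSeq hs g hg → ∀ i < k, ∃ j < k, g j = f i := by
    intro f g hf hg h0 e i hi
    have : pt n (f i) ∈ (ofSeq hs g hg).1.1 := by rw [← e]; exact mem_ofSeq.2 ⟨i, hi, rfl⟩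
    obtain ⟨j, hj, e'⟩ := mem_ofSeq.1 this
    refine ⟨j, hj, pt_injOn e' ?_ ?_⟩
    · rcases Nat.eq_zero_or_pos i with rfl | hi'
      · rcases Nat.eq_zero_or_pos j with rfl | hj'
        · have := n_pos_int (n := n); omega
        · have := hg 0 j hj' hj; omega
      · rcases Nat.eq_zero_or_pos j with rfl | hj'
        · have := hf 0 i hi' hi; omega
        · have := hg 0 j hj' hj; have := hf 0 i hi' hi; omega
    · rcases Nat.eq_zero_or_pos i with rfl | hi'
      · rcases Nat.eq_zero_or_pos j with rfl | hj'
        · have := n_pos_int (n := n); omega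
        · have := hg 0 j hj' hj; omega
      · rcases Nat.eq_zero_or_pos j with rfl | hj'
        · have := hf 0 i hi' hi; omega
        · have := hg 0 j hj' hj; have := hf 0 i hi' hi; omega
  have mono : ∀ {f : ℕ → ℤ}, Adm n k s f → StrictMono fun i : Fin k => f i := by
    intro f hf i j hij
    have := hf i j hij j.2
    simp only
    omega
  have hr : Set.range (fun i : Fin k => f i) = Set.range fun i : Fin k => g i := by
    apply Set.Subset.antisymm
    · rintro _ ⟨i, rfl⟩
      obtain ⟨j, hj, e'⟩ := key h0 e i i.2
      exact ⟨⟨j, hj⟩, e'⟩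
    · rintro _ ⟨i, rfl⟩
      obtain ⟨j, hj, e'⟩ := key h0.symm e.symm i i.2
      exact ⟨⟨j, hj⟩, e'⟩
  exact congrFun ((StrictMono.range_inj (mono hf) (mono hg)).1 hr) ⟨i, hi⟩

end Vertices

/-! ### Elementary moves -/

/-- The vertex `u` arises from `v` by moving its element `x` to a point `y` at distance less
than `s`. -/
def MoveAt {n k s : ℕ} (v u : Vertex n k s) (x y : Fin n) : Prop :=
  x ∈ v.1.1 ∧ y ∉ v.1.1 ∧ ¬ Far s x y ∧ u.1.1 = insert y (v.1.1.erase x)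

/-- Two vertices differ by a move of one element over a distance less than `s`. -/
def Move {n k s : ℕ} (v u : Vertex n k s) : Prop := ∃ x y, MoveAt v u x y

section Moves

variable {n k s : ℕ} {v u w : Vertex n k s} {x y x' y' : Fin n}

theorem MoveAt.ne_points (h : MoveAt v u x y) : x ≠ y := fun e => h.2.1 (e ▸ h.1)

theorem MoveAt.mem_iff (h : MoveAt v u x y) (z : Fin n) :
    z ∈ u.1.1 ↔ z = y ∨ (z ≠ x ∧ z ∈ v.1.1) := by
  rw [h.2.2.2]; simp

theorem MoveAt.symm (h : MoveAt v u x y) : MoveAt u v y x := by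
  have hne := h.ne_points
  have hm := h.mem_iff
  obtain ⟨h1, h2, h3, h4⟩ := h
  refine ⟨(hm y).2 (Or.inl rfl), ?_, fun hf => h3 hf.symm, ?_⟩
  · rw [hm]; tauto
  · ext z
    simp only [Finset.mem_insert, Finset.mem_erase, hm]
    by_cases hz : z = x <;> by_cases hz' : z = y <;> subst_vars <;> tauto

theorem Move.symm (h : Move v u) : Move u v := by
  obtain ⟨x, y, h⟩ := h
  exact ⟨y, x, h.symm⟩

theorem MoveAt.ne (h : MoveAt v u x y) : v ≠ u := by
  rintro rfl
  exact h.2.1 ((h.mem_iff y).2 (Or.inl rfl))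

/-- The labels of a move are determined by its end vertices. -/
theorem MoveAt.unique (h : MoveAt v u x y) (h' : MoveAt v u x' y') : x = x' ∧ y = y' := by
  have hm := h.mem_iff
  have hm' := h'.mem_iff
  have hs := h.symm
  have hs' := h'.symm
  constructor
  · have : x ∉ u.1.1 := hs.2.1
    rw [hm'] at this
    have := h.1
    tauto
  · have : y ∈ u.1.1 := hs.1
    rw [hm'] at this
    have := h.2.1
    tauto

theorem MoveAt.of_eq (h : MoveAt v u x y) (h1 : x' ∈ v.1.1) (h2 : y' ∉ v.1.1)
    (h3 : u.1.1 = insert y' (v.1.1.erase x')) : MoveAt v u x' y' := by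
  have hm := h.mem_iff
  have hm' : ∀ z, z ∈ u.1.1 ↔ z = y' ∨ (z ≠ x' ∧ z ∈ v.1.1) := by
    intro z; rw [h3]; simp
  have hx : x = x' := by
    have : x ∉ u.1.1 := h.symm.2.1
    rw [hm'] at this
    have := h.1
    tauto
  have hy : y = y' := by
    have : y ∈ u.1.1 := h.symm.1
    rw [hm'] at this
    have := h.2.1
    tauto
  rw [← hx, ← hy]; exact h

variable [NeZero n]

theorem moveAt_of_mem (hns : s ≤ n) {a b : ℤ} (h1 : a < b) (h2 : b < a + s)
    (ha : pt n a ∈ v.1.1)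
    (hu : u.1.1 = insert (pt n b) (v.1.1.erase (pt n a))) : MoveAt v u (pt n a) (pt n b) := by
  have hf : ¬ Far s (pt n a) (pt n b) := by
    rw [far_pt (by omega) (by omega)]; omega
  refine ⟨ha, fun hb => hf (v.far ha hb fun e => ?_), hf, hu⟩
  have := pt_injOn e (by omega) (by omega)
  omega

/-- Raising one term of an admissible sequence by less than `s` is a move. -/
theorem moveAt_ofSeq (hs : 1 ≤ s) (hns : s ≤ n) {f g : ℕ → ℤ} {i : ℕ} (hf : Adm n k s f)
    (hg : Adm n k s g) (hi : i < k) (hfg : ∀ j < k, j ≠ i → g j = f j) (h1 : f i < g i)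
    (h2 : g i < f i + s) :
    MoveAt (ofSeq hs f hf) (ofSeq hs g hg) (pt n (f i)) (pt n (g i)) := by
  refine moveAt_of_mem hns h1 h2 (mem_ofSeq.2 ⟨i, hi, rfl⟩) ?_
  ext z
  simp only [Finset.mem_insert, Finset.mem_erase, mem_ofSeq]
  constructor
  · rintro ⟨j, hj, rfl⟩
    by_cases hij : j = i
    · left; rw [hij]
    · right
      rw [hfg j hj hij]
      exact ⟨fun e => hij (hf.injOn hs hj hi e), j, hj, rfl⟩
  · rintro (rfl | ⟨hz, j, hj, rfl⟩)
    · exact ⟨i, hi, rfl⟩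
    · have hij : j ≠ i := fun e => hz (by rw [e])
      exact ⟨j, hj, by rw [hfg j hj hij]⟩

end Moves

section Translates

variable {n k s : ℕ} [NeZero n]

/-- The vertex `v` rotated by the integer `e`. -/
def rotateV (e : ℤ) (v : Vertex n k s) : Vertex n k s :=
  rotationAut n k s (e % (n : ℤ)).toNat v

theorem mem_rotationAut (i : ℕ) (v : Vertex n k s) (c : ℤ) :
    pt n c ∈ (rotationAut n k s i v).1.1 ↔ pt n (c - i) ∈ v.1.1 := by
  have h : pt n c = (finRotate n ^ i) (pt n (c - i)) := by
    rw [finRotate_pow_pt]; congr 1; ring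
  change pt n c ∈ v.1.1.map (finRotate n ^ i).toEmbedding ↔ _
  rw [h]
  exact Finset.mem_map' (finRotate n ^ i).toEmbedding

theorem mem_rotateV (e : ℤ) (v : Vertex n k s) (c : ℤ) :
    pt n c ∈ (rotateV e v).1.1 ↔ pt n (c - e) ∈ v.1.1 := by
  have h0 := n_pos_int (n := n)
  have h1 := Int.emod_nonneg e h0.ne'
  unfold rotateV
  rw [mem_rotationAut, Int.toNat_of_nonneg h1]
  have : pt n (c - e % n) = pt n (c - e) := pt_sub_congr (pt_eq_iff.2 (by simp)) c
  rw [this]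

/-- A vertex contains no two distinct points at distance less than `s`. -/
theorem Vertex.not_close (hns : s ≤ n) (v : Vertex n k s) {a b : ℤ} (ha : pt n a ∈ v.1.1)
    (hb : pt n b ∈ v.1.1) (h1 : a < b) (h2 : b < a + s) : False := by
  have hne : pt n a ≠ pt n b := fun e => by
    have := pt_injOn e (by omega) (by omega)
    omega
  have := (far_pt (by omega) (by omega)).1 (v.far ha hb hne)
  omega

theorem disjoint_of_pt {S T : Finset (Fin n)} (h : ∀ c, pt n c ∈ S → pt n c ∈ T → False) :
    Disjoint S T := by
  rw [Finset.disjoint_left]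
  intro z h1 h2
  obtain ⟨c, -, -, rfl⟩ := exists_pt 0 z
  exact h c h1 h2

theorem rotateV_disjoint (hns : s ≤ n) (v : Vertex n k s) {e : ℤ} (h1 : 1 ≤ e) (h2 : e < s) :
    Disjoint (rotateV e v).1.1 v.1.1 := by
  apply disjoint_of_pt
  intro c hc hc'
  rw [mem_rotateV] at hc
  exact v.not_close hns hc hc' (by omega) (by omega)

theorem rotateV_neg_disjoint (hns : s ≤ n) (v : Vertex n k s) {e : ℤ} (h1 : 1 ≤ e)
    (h2 : e < s) : Disjoint (rotateV (-e) v).1.1 v.1.1 := by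
  apply disjoint_of_pt
  intro c hc hc'
  rw [mem_rotateV] at hc
  exact v.not_close hns hc' hc (by omega) (by omega)

/-- A point `c` far from all of `u` lies on a vertex that avoids `u` and consists, apart from `c`,
of points of `u` moved by one step. -/
theorem exists_vertex_of_far (hk : 1 ≤ k) (hs : 2 ≤ s) (u : Vertex n k s) (c : ℤ)
    (hc : pt n c ∉ u.1.1)
    (hf : ∀ e : ℤ, 1 ≤ e → e < s → pt n (c - e) ∉ u.1.1 ∧ pt n (c + e) ∉ u.1.1) :
    ∃ z : Vertex n k s, pt n c ∈ z.1.1 ∧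
      ∀ b, pt n b ∈ z.1.1 → pt n b = pt n c ∨ pt n (b - 1) ∈ u.1.1 := by
  -- Only the point at distance exactly `s` before `c` can come too near to `c`; it is dropped.
  obtain ⟨p, hp, hps⟩ : ∃ p, pt n p ∈ u.1.1 ∧ (pt n (c - s) ∈ u.1.1 → pt n p = pt n (c - s)) := by
    by_cases h : pt n (c - s) ∈ u.1.1
    · exact ⟨_, h, fun _ => rfl⟩
    · obtain ⟨x, hx⟩ : u.1.1.Nonempty := Finset.card_pos.1 (by rw [u.1.2]; omega)
      obtain ⟨p, -, -, rfl⟩ := exists_pt 0 x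
      exact ⟨p, hx, fun h' => absurd h' h⟩
  have hW : pt n (p + 1) ∈ (rotateV 1 u).1.1 := by
    rw [mem_rotateV]; simpa using hp
  have hcW : pt n c ∉ (rotateV 1 u).1.1 := by
    rw [mem_rotateV]; exact (hf 1 le_rfl (by omega)).1
  have hfar : ∀ q ∈ (rotateV 1 u).1.1, q ≠ pt n (p + 1) → Far s (pt n c) q := by
    intro q hq hqp
    obtain ⟨b, hb1, hb2, rfl⟩ := exists_pt c q
    rw [mem_rotateV] at hq
    rw [far_pt hb1 (by omega)]
    constructor
    · by_contra hlt
      push Not at hlt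
      rcases eq_or_lt_of_le hb1 with rfl | hb1
      · exact (hf 1 le_rfl (by omega)).1 hq
      · rcases eq_or_lt_of_le (show c + 1 ≤ b by omega) with rfl | hb
        · rw [add_sub_cancel_right] at hq; exact hc hq
        · refine (hf (b - 1 - c) (by omega) (by omega)).2 ?_
          rwa [add_sub_cancel]
    · by_contra hlt
      push Not at hlt
      have e : pt n (b - 1) = pt n (c - (c + n - b + 1)) := by
        rw [← pt_add_n (c - (c + n - b + 1))]; congr 1; ring
      rw [e] at hq
      by_cases hes : c + n - b + 1 = (s : ℤ)
      · rw [hes] at hq e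
        refine hqp ?_
        have := pt_add_congr (e.trans (hps hq).symm) 1
        simpa using this
      · exact (hf _ (by omega) (by omega)).1 hq
  refine ⟨mkVertex (insert (pt n c) ((rotateV 1 u).1.1.erase (pt n (p + 1)))) ?_ ?_, ?_, ?_⟩
  · rw [Finset.card_insert_of_notMem fun h => hcW (Finset.mem_of_mem_erase h),
      Finset.card_erase_of_mem hW, (rotateV 1 u).1.2]
    omega
  · intro x hx y hy hxy
    simp only [Finset.mem_insert, Finset.mem_erase] at hx hy
    rcases hx with rfl | hx <;> rcases hy with rfl | hy
    · exact absurd rfl hxy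
    · exact hfar y hy.2 hy.1
    · exact (hfar x hx.2 hx.1).symm
    · exact Vertex.far _ hx.2 hy.2 hxy
  · exact Finset.mem_insert_self _ _
  · intro b hb
    rcases Finset.mem_insert.1 hb with hb | hb
    · exact Or.inl hb
    · right; exact (mem_rotateV _ _ _).1 (Finset.mem_of_mem_erase hb)

/-- The union of the two ends of a move in the positive direction is closed. -/
theorem exists_vertex_of_move_aux (hk : 1 ≤ k) (hs : 2 ≤ s) (hn : 2 * s ≤ n) {v u : Vertex n k s}
    {a d : ℤ} (hd : 1 ≤ d) (hds : d < s) (h : MoveAt v u (pt n a) (pt n (a + d)))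
    {z : Fin n} (hzv : z ∉ v.1.1) (hzu : z ∉ u.1.1) :
    ∃ w : Vertex n k s, z ∈ w.1.1 ∧ Disjoint w.1.1 v.1.1 ∧ Disjoint w.1.1 u.1.1 := by
  have hns : s ≤ n := by omega
  obtain ⟨c, -, -, rfl⟩ := exists_pt 0 z
  have hmu := h.mem_iff
  have hmv := h.symm.mem_iff
  have hxv := h.1
  have hyu := h.symm.1
  have ne : ∀ {p q : ℤ}, p < q → q < p + n → pt n p ≠ pt n q := fun h1 h2 e => by
    have := pt_injOn e (by omega) (by omega)
    omega
  -- Rotations of `u` and `v` by less than `s` avoid `u ∪ v`, up to one exceptional amount.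
  have hA : ∀ e : ℤ, 1 ≤ e → e < s → Disjoint (rotateV e u).1.1 v.1.1 := by
    intro e h1 h2
    apply disjoint_of_pt
    intro b hb hbv
    rcases (hmv _).1 hbv with e' | ⟨-, hbu⟩
    · rw [mem_rotateV, sub_eq_add_neg, pt_add_congr e' (-e)] at hb
      rcases (hmu _).1 hb with e'' | ⟨-, hb⟩
      · exact ne (by omega) (by omega) e''
      · exact v.not_close hns hb hxv (by omega) (by omega)
    · exact Finset.disjoint_left.1 (rotateV_disjoint hns u h1 h2) hb hbu
  have hB : ∀ e : ℤ, 1 ≤ e → e < s → Disjoint (rotateV (-e) v).1.1 u.1.1 := by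
    intro e h1 h2
    apply disjoint_of_pt
    intro b hb hbu
    rcases (hmu _).1 hbu with e' | ⟨-, hbv⟩
    · rw [mem_rotateV, sub_neg_eq_add, pt_add_congr e' e] at hb
      rcases (hmv _).1 hb with e'' | ⟨-, hb⟩
      · exact ne (by omega) (by omega) e''.symm
      · exact u.not_close hns hyu hb (by omega) (by omega)
    · exact Finset.disjoint_left.1 (rotateV_neg_disjoint hns v h1 h2) hb hbv
  have hC : ∀ e : ℤ, 1 ≤ e → e < s → e ≠ d → Disjoint (rotateV (-e) u).1.1 v.1.1 := by
    intro e h1 h2 hed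
    apply disjoint_of_pt
    intro b hb hbv
    rcases (hmv _).1 hbv with e' | ⟨-, hbu⟩
    · rw [mem_rotateV, sub_neg_eq_add, pt_add_congr e' e] at hb
      rcases (hmu _).1 hb with e'' | ⟨-, hb⟩
      · have := pt_injOn e'' (by omega) (by omega)
        omega
      · exact v.not_close hns hxv hb (by omega) (by omega)
    · exact Finset.disjoint_left.1 (rotateV_neg_disjoint hns u h1 h2) hb hbu
  have hD : ∀ e : ℤ, 1 ≤ e → e < s → e ≠ d → Disjoint (rotateV e v).1.1 u.1.1 := by
    intro e h1 h2 hed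
    apply disjoint_of_pt
    intro b hb hbu
    rcases (hmu _).1 hbu with e' | ⟨-, hbv⟩
    · rw [mem_rotateV, sub_eq_add_neg, pt_add_congr e' (-e)] at hb
      rcases lt_or_gt_of_ne hed with h' | h'
      · exact v.not_close hns hxv hb (by omega) (by omega)
      · exact v.not_close hns hb hxv (by omega) (by omega)
    · exact Finset.disjoint_left.1 (rotateV_disjoint hns v h1 h2) hb hbv
  by_cases h1 : ∃ e : ℤ, 1 ≤ e ∧ e < s ∧ pt n (c - e) ∈ u.1.1
  · obtain ⟨e, he1, he2, he⟩ := h1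
    exact ⟨rotateV e u, (mem_rotateV _ _ _).2 he, hA e he1 he2, rotateV_disjoint hns u he1 he2⟩
  by_cases h2 : ∃ e : ℤ, 1 ≤ e ∧ e < s ∧ pt n (c + e) ∈ v.1.1
  · obtain ⟨e, he1, he2, he⟩ := h2
    exact ⟨rotateV (-e) v, (mem_rotateV _ _ _).2 (by simpa using he),
      rotateV_neg_disjoint hns v he1 he2, hB e he1 he2⟩
  by_cases h3 : ∃ e : ℤ, 1 ≤ e ∧ e < s ∧ pt n (c + e) ∈ u.1.1
  · obtain ⟨e, he1, he2, he⟩ := h3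
    refine ⟨rotateV (-e) u, (mem_rotateV _ _ _).2 (by simpa using he), hC e he1 he2 ?_,
      rotateV_neg_disjoint hns u he1 he2⟩
    rintro rfl
    rcases (hmu _).1 he with e' | ⟨-, he⟩
    · have := pt_add_congr e' (-e)
      simp only [add_neg_cancel_right] at this
      exact hzv (this ▸ hxv)
    · exact h2 ⟨e, he1, he2, he⟩
  by_cases h4 : ∃ e : ℤ, 1 ≤ e ∧ e < s ∧ pt n (c - e) ∈ v.1.1
  · obtain ⟨e, he1, he2, he⟩ := h4
    refine ⟨rotateV e v, (mem_rotateV _ _ _).2 he, rotateV_disjoint hns v he1 he2,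
      hD e he1 he2 ?_⟩
    rintro rfl
    rcases (hmv _).1 he with e' | ⟨-, he⟩
    · have := pt_add_congr e' e
      simp only [sub_add_cancel] at this
      exact hzu (this ▸ hyu)
    · exact h1 ⟨e, he1, he2, he⟩
  obtain ⟨w, hw, hw'⟩ := exists_vertex_of_far hk hs u c hzu fun e he1 he2 =>
    ⟨fun h => h1 ⟨e, he1, he2, h⟩, fun h => h3 ⟨e, he1, he2, h⟩⟩
  refine ⟨w, hw, disjoint_of_pt fun b hb hbv => ?_, disjoint_of_pt fun b hb hbu => ?_⟩
  · rcases hw' b hb with e | hb'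
    · exact hzv (e ▸ hbv)
    · exact Finset.disjoint_left.1 (hA 1 le_rfl (by omega)) ((mem_rotateV _ _ _).2 hb') hbv
  · rcases hw' b hb with e | hb'
    · exact hzu (e ▸ hbu)
    · exact Finset.disjoint_left.1 (rotateV_disjoint hns u le_rfl (by omega))
        ((mem_rotateV _ _ _).2 hb') hbu

theorem MoveAt.coords {v u : Vertex n k s} {x y : Fin n} (h : MoveAt v u x y) :
    ∃ a d : ℤ, 1 ≤ d ∧ d < s ∧
      (x = pt n a ∧ y = pt n (a + d) ∨ y = pt n a ∧ x = pt n (a + d)) := by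
  obtain ⟨a, -, -, rfl⟩ := exists_pt 0 x
  obtain ⟨b, hb1, hb2, rfl⟩ := exists_pt a y
  have hne := h.ne_points
  have hf := h.2.2.1
  rw [far_pt hb1 (by omega)] at hf
  have hab : a ≠ b := fun e => hne (by rw [e])
  by_cases hb : b < a + s
  · exact ⟨a, b - a, by omega, by omega, Or.inl ⟨rfl, by rw [add_sub_cancel]⟩⟩
  · refine ⟨b, a + n - b, by omega, by omega, Or.inr ⟨rfl, ?_⟩⟩
    rw [add_sub_cancel, pt_add_n]

/-- The union of the two ends `v`, `u` of a move is closed: each point outside of it lies on a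
common neighbour of `v` and `u`. -/
theorem MoveAt.exists_vertex (hk : 1 ≤ k) (hs : 2 ≤ s) (hn : 2 * s ≤ n) {v u : Vertex n k s}
    {x y : Fin n} (h : MoveAt v u x y) {z : Fin n} (hzv : z ∉ v.1.1) (hzu : z ∉ u.1.1) :
    ∃ w : Vertex n k s, z ∈ w.1.1 ∧ Disjoint w.1.1 v.1.1 ∧ Disjoint w.1.1 u.1.1 := by
  obtain ⟨a, d, h1, h2, ⟨rfl, rfl⟩ | ⟨rfl, rfl⟩⟩ := h.coords
  · exact exists_vertex_of_move_aux hk hs hn h1 h2 h hzv hzu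
  · obtain ⟨w, hw, hw1, hw2⟩ := exists_vertex_of_move_aux hk hs hn h1 h2 h.symm hzu hzv
    exact ⟨w, hw, hw2, hw1⟩

end Translates

/-! ### Moves are determined by the graph -/

section MoveGraph

variable {n k s : ℕ} [NeZero n]

/-- Two distinct vertices with a common point whose union contains no third vertex differ by a
move. With both sets listed in increasing order from the common point, termwise minima and
sequences that switch from one list to the other are again vertices inside the union. -/
theorem move_of_subset (hk : 2 ≤ k) (hs : 1 ≤ s) {v u : Vertex n k s} (hne : v ≠ u)
    (hdis : ¬ Disjoint v.1.1 u.1.1)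
    (h : ∀ w : Vertex n k s, w.1.1 ⊆ v.1.1 ∪ u.1.1 → w = v ∨ w = u) : Move v u := by
  obtain ⟨x, hxv, hxu⟩ := Finset.not_disjoint_iff.1 hdis
  obtain ⟨a, -, -, rfl⟩ := exists_pt 0 x
  obtain ⟨f, hf, hf0, hvf⟩ := exists_ofSeq hs v hxv
  obtain ⟨g, hg, hg0, hug⟩ := exists_ofSeq hs u hxu
  have main : ∀ {v u : Vertex n k s} {f g : ℕ → ℤ} (hf : Adm n k s f) (hg : Adm n k s g),
      v ≠ u → f 0 = g 0 → (∀ i < k, f i ≤ g i) → v = ofSeq hs f hf → u = ofSeq hs g hg →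
      (∀ w : Vertex n k s, w.1.1 ⊆ v.1.1 ∪ u.1.1 → w = v ∨ w = u) → Move v u := by
    intro v u f g hf hg hne h0 hle hvf hug h
    obtain ⟨j, hj, hfg⟩ : ∃ j < k, f j ≠ g j := by
      by_contra hall
      push Not at hall
      refine hne (Vertex.eq_of_subset fun z hz => ?_)
      rw [hvf] at hz
      obtain ⟨i, hi, rfl⟩ := mem_ofSeq.1 hz
      rw [hug, hall i hi]
      exact mem_ofSeq.2 ⟨i, hi, rfl⟩
    have hj0 : 0 < j := by
      rcases Nat.eq_zero_or_pos j with rfl | hj0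
      · exact absurd h0 hfg
      · exact hj0
    have hlt : f j < g j := lt_of_le_of_ne (hle j hj) hfg
    have hyb : ∀ t, 0 < t → Adm n k s fun i => if i < t then f i else g i := by
      intro t ht i l hil hl
      have h1 := hf i l hil hl
      have h2 := hg i l hil hl
      have h3 := hg 0 l (by omega) hl
      have h4 := hle l hl
      have h5 := hle i (by omega)
      have h6 : f 0 ≤ f i := by
        rcases Nat.eq_zero_or_pos i with rfl | hi
        · exact le_rfl
        · have := hf 0 i hi (by omega); omega
      by_cases hi : i < t <;> by_cases hl' : l < t <;> simp only [hi, hl', if_true, if_false] <;>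
        omega
    have hsub : ∀ t (ht : 0 < t), (ofSeq hs _ (hyb t ht)).1.1 ⊆ v.1.1 ∪ u.1.1 := by
      intro t ht z hz
      obtain ⟨i, hi, rfl⟩ := mem_ofSeq.1 hz
      rw [Finset.mem_union, hvf, hug]
      by_cases hit : i < t
      · left; simp only [hit, if_true]; exact mem_ofSeq.2 ⟨i, hi, rfl⟩
      · right; simp only [hit, if_false]; exact mem_ofSeq.2 ⟨i, hi, rfl⟩
    have heq : ∀ i < k, i ≠ j → f i = g i := by
      intro i hi hij
      rcases lt_or_gt_of_ne hij with hij | hij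
      · rcases h _ (hsub j hj0) with e | e
        · rw [hvf] at e
          have := ofSeq_inj (by simp [hj0]) e hj
          simp at this
          omega
        · rw [hug] at e
          have := ofSeq_inj (by simpa [hj0] using h0) e hi
          simpa [hij] using this
      · rcases h _ (hsub (j + 1) (by omega)) with e | e
        · rw [hvf] at e
          have := ofSeq_inj (by simp) e hi
          have hij' : ¬ i < j + 1 := by omega
          simpa [hij'] using this.symm
        · rw [hug] at e
          have := ofSeq_inj (by simpa using h0) e hj
          simp at this
          omega
    have hmv : ∀ {z}, z ∈ v.1.1 ↔ ∃ i < k, pt n (f i) = z := by rw [hvf]; exact mem_ofSeq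
    have hmu : ∀ {z}, z ∈ u.1.1 ↔ ∃ i < k, pt n (g i) = z := by rw [hug]; exact mem_ofSeq
    have hxv : pt n (f j) ∈ v.1.1 := hmv.2 ⟨j, hj, rfl⟩
    have hu : ∀ z, z ∈ u.1.1 ↔ z = pt n (g j) ∨ (z ≠ pt n (f j) ∧ z ∈ v.1.1) := by
      intro z
      constructor
      · intro hz
        obtain ⟨i, hi, rfl⟩ := hmu.1 hz
        by_cases hij : i = j
        · left; rw [hij]
        · right
          rw [← heq i hi hij]
          exact ⟨fun e => hij (hf.injOn hs hi hj e), hmv.2 ⟨i, hi, rfl⟩⟩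
      · rintro (rfl | ⟨hz, hzv⟩)
        · exact hmu.2 ⟨j, hj, rfl⟩
        · obtain ⟨i, hi, rfl⟩ := hmv.1 hzv
          have hij : i ≠ j := fun e => hz (by rw [e])
          exact hmu.2 ⟨i, hi, by rw [heq i hi hij]⟩
    have hgj := hg 0 j hj0 hj
    have hfj := hf 0 j hj0 hj
    have hyv : pt n (g j) ∉ v.1.1 := by
      intro hy
      refine hne (Vertex.eq_of_subset fun z hz => ?_).symm
      rcases (hu z).1 hz with rfl | hz
      · exact hy
      · exact hz.2
    have huv : u.1.1 = insert (pt n (g j)) (v.1.1.erase (pt n (f j))) := by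
      ext z; rw [hu]; simp
    refine ⟨_, _, hxv, hyv, fun hfar => ?_, huv⟩
    -- If the two points were far, both could be kept, at the expense of the common point.
    have hxy : pt n (f j) ≠ pt n (g j) := fun e => hyv (e ▸ hxv)
    have hpv : pt n (f 0) ∈ v.1.1 := hmv.2 ⟨0, by omega, rfl⟩
    have hpx : pt n (f 0) ≠ pt n (f j) := fun e => by
      have := hf.injOn hs (by omega) hj e; omega
    have hyfar : ∀ z ∈ v.1.1, Far s z (pt n (g j)) := by
      intro z hz
      by_cases hzx : z = pt n (f j)
      · rw [hzx]; exact hfar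
      · exact u.far ((hu z).2 (Or.inr ⟨hzx, hz⟩)) ((hu _).2 (Or.inl rfl)) fun e => hyv (e ▸ hz)
    let w : Vertex n k s := mkVertex (insert (pt n (g j)) (v.1.1.erase (pt n (f 0))))
      (by
        rw [Finset.card_insert_of_notMem fun h => hyv (Finset.mem_of_mem_erase h),
          Finset.card_erase_of_mem hpv, v.1.2]
        omega)
      (by
        intro z hz z' hz' hzz
        simp only [Finset.mem_insert, Finset.mem_erase] at hz hz'
        rcases hz with rfl | hz <;> rcases hz' with rfl | hz'
        · exact absurd rfl hzz
        · exact (hyfar _ hz'.2).symm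
        · exact hyfar _ hz.2
        · exact v.far hz.2 hz'.2 hzz)
    have hyw : pt n (g j) ∈ w.1.1 := Finset.mem_insert_self _ _
    have hxw : pt n (f j) ∈ w.1.1 :=
      Finset.mem_insert_of_mem (Finset.mem_erase.2 ⟨hpx.symm, hxv⟩)
    rcases h w (by
      intro z hz
      rcases Finset.mem_insert.1 hz with rfl | hz
      · exact Finset.mem_union_right _ ((hu _).2 (Or.inl rfl))
      · exact Finset.mem_union_left _ (Finset.mem_of_mem_erase hz)) with e | e
    · exact hyv (e ▸ hyw)
    · have := (hu _).1 (e ▸ hxw)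
      tauto
  have hmin : Adm n k s fun i => min (f i) (g i) := by
    intro i j hij hj
    have h1 := hf i j hij hj
    have h2 := hg i j hij hj
    change min (f i) (g i) + s ≤ min (f j) (g j) ∧ min (f j) (g j) + s ≤ min (f i) (g i) + n
    omega
  have h0 : min (f 0) (g 0) = f 0 := by rw [hf0, hg0, min_self]
  rcases h (ofSeq hs _ hmin) (by
    intro z hz
    obtain ⟨i, hi, rfl⟩ := mem_ofSeq.1 hz
    rw [Finset.mem_union, hvf, hug]
    rcases min_choice (f i) (g i) with e | e
    · left; rw [e]; exact mem_ofSeq.2 ⟨i, hi, rfl⟩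
    · right; rw [e]; exact mem_ofSeq.2 ⟨i, hi, rfl⟩) with e | e
  · rw [hvf] at e
    refine main hf hg hne (hf0.trans hg0.symm) (fun i hi => ?_) hvf hug h
    have := ofSeq_inj h0 e hi
    omega
  · rw [hug] at e
    refine (main hg hf hne.symm (hg0.trans hf0.symm) (fun i hi => ?_) hug hvf ?_).symm
    · have := ofSeq_inj (h0.trans (hf0.trans hg0.symm)) e hi
      omega
    · intro w hw
      rw [Finset.union_comm] at hw
      exact (h w hw).symm

/-- Moves are described by adjacency alone: `v` and `u` are not adjacent, and besides them no vertex
is adjacent to all of their common neighbours. -/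
theorem move_iff (hk : 2 ≤ k) (hs : 2 ≤ s) (hn : 2 * s ≤ n) {v u : Vertex n k s} :
    Move v u ↔ v ≠ u ∧ ¬ (stableKneserGraph n k s).Adj v u ∧
      ∀ w, (∀ z, (stableKneserGraph n k s).Adj z v → (stableKneserGraph n k s).Adj z u →
        (stableKneserGraph n k s).Adj z w) → w = v ∨ w = u := by
  simp only [adj_iff (show 1 ≤ k by omega)]
  constructor
  · rintro ⟨x, y, h⟩
    refine ⟨h.ne, ?_, ?_⟩
    · obtain ⟨p, hp⟩ : (v.1.1.erase x).Nonempty := by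
        apply Finset.card_pos.1
        rw [Finset.card_erase_of_mem h.1, v.1.2]; omega
      have hp := Finset.mem_erase.1 hp
      exact Finset.not_disjoint_iff.2 ⟨p, hp.2, (h.mem_iff p).2 (Or.inr hp)⟩
    · intro w hw
      by_cases hyw : y ∈ w.1.1
      · right
        apply Vertex.eq_of_subset
        intro z hz
        by_contra hzu
        have hzx : z ≠ x := by
          rintro rfl
          exact h.2.2.1 (Vertex.far w hz hyw h.ne_points)
        have hzv : z ∉ v.1.1 := fun hzv => hzu ((h.mem_iff z).2 (Or.inr ⟨hzx, hzv⟩))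
        obtain ⟨t, ht, ht1, ht2⟩ := h.exists_vertex (by omega) hs hn hzv hzu
        exact Finset.disjoint_left.1 (hw t ht1 ht2) ht hz
      · left
        apply Vertex.eq_of_subset
        intro z hz
        by_contra hzv
        have hzu : z ∉ u.1.1 := by
          intro hzu
          rcases (h.mem_iff z).1 hzu with rfl | hzu
          · exact hyw hz
          · exact hzv hzu.2
        obtain ⟨t, ht, ht1, ht2⟩ := h.exists_vertex (by omega) hs hn hzv hzu
        exact Finset.disjoint_left.1 (hw t ht1 ht2) ht hz
  · rintro ⟨hne, hdis, h⟩
    refine move_of_subset hk (by omega) hne hdis fun w hw => h w fun z hz1 hz2 => ?_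
    exact Finset.disjoint_of_subset_right hw (Finset.disjoint_union_right.2 ⟨hz1, hz2⟩)

/-- Automorphisms preserve moves. -/
theorem move_map (hk : 2 ≤ k) (hs : 2 ≤ s) (hn : 2 * s ≤ n)
    (φ : stableKneserGraph n k s ≃g stableKneserGraph n k s) {v u : Vertex n k s} :
    Move (φ v) (φ u) ↔ Move v u := by
  rw [move_iff hk hs hn, move_iff hk hs hn]
  refine and_congr (by simp) (and_congr (by rw [φ.map_adj_iff]) ?_)
  constructor
  · intro h w hw
    refine (h (φ w) fun z h1 h2 => ?_).imp (φ.injective ·) (φ.injective ·)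
    obtain ⟨z, rfl⟩ := φ.surjective z
    rw [φ.map_adj_iff] at *
    exact hw z h1 h2
  · intro h w hw
    obtain ⟨w, rfl⟩ := φ.surjective w
    refine (h w fun z h1 h2 => ?_).imp (congrArg φ) (congrArg φ)
    have := hw (φ z) (φ.map_adj_iff.2 h1) (φ.map_adj_iff.2 h2)
    exact φ.map_adj_iff.1 this

end MoveGraph

/-! ### Squares of moves -/

section Squares

variable {n k s : ℕ} [NeZero n]

/-- In a 4-cycle of moves without diagonals, opposite sides carry the same move. -/
theorem square_moveAt (hk : 2 ≤ k) {A B C D : Vertex n k s}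
    (hBC : Move B C) (hDC : Move D C) (hAD : Move A D)
    (hAC : A ≠ C) (hBD : B ≠ D) (hAC' : ¬ Move A C) (hBD' : ¬ Move B D) {a a' : Fin n}
    (hl : MoveAt A B a a') : MoveAt D C a a' := by
  obtain ⟨e, e', hD⟩ := hAD
  obtain ⟨q, y, hC⟩ := hBC
  obtain ⟨r, y', hC'⟩ := hDC
  have mB := hl.mem_iff
  have mD := hD.mem_iff
  have mC := hC.mem_iff
  have mC' := hC'.mem_iff
  have haB : a ∉ B.1.1 := hl.symm.2.1
  have heD : e ∉ D.1.1 := hD.symm.2.1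
  have haB' : a' ∈ B.1.1 := hl.symm.1
  have heD' : e' ∈ D.1.1 := hD.symm.1
  by_cases hae : a = e
  · -- Both moves concern the same element: the window in which it moves is an interval, and the
    -- four positions would have a diagonal.
    exfalso
    subst hae
    have hne : a' ≠ e' := by
      rintro rfl
      exact hBD (Vertex.ext (by rw [hl.2.2.2, hD.2.2.2]))
    have hae' : e' ≠ a := hD.ne_points.symm
    have hfar : Far s a' e' := by
      by_contra hf
      refine hBD' ⟨a', e', haB', ?_, hf, ?_⟩
      · rw [mB]
        rintro (h | h)
        · exact hne h.symm
        · exact hD.2.1 h.2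
      · ext z
        have hza' : z ∈ A.1.1 → z ≠ a' := fun h e => hl.2.1 (e ▸ h)
        rw [Finset.mem_insert, Finset.mem_erase, mB, mD]
        tauto
    by_cases hq : q = a'
    · subst hq
      have hye' : y ≠ e' := by
        rintro rfl
        refine hC'.ne (Vertex.eq_of_subset fun z hz => ?_)
        rw [mC]
        rcases (mD z).1 hz with h | h
        · exact Or.inl h
        · exact Or.inr ⟨fun e => hl.2.1 (e ▸ h.2), (mB z).2 (Or.inr h)⟩
      have he'C : e' ∉ C.1.1 := by
        rw [mC, mB]
        rintro (h | ⟨-, h | h⟩)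
        · exact hye' h.symm
        · exact hne h.symm
        · exact hD.2.1 h.2
      have hr : r = e' := by
        by_contra hr
        exact he'C ((mC' e').2 (Or.inr ⟨fun e => hr e.symm, heD'⟩))
      subst hr
      have hyC : y ∈ C.1.1 := hC.symm.1
      have hyy : y' = y := by
        rcases (mC y').1 hC'.symm.1 with h | ⟨h1, h2⟩
        · exact h
        · rcases (mB y').1 h2 with h | h
          · exact absurd h h1
          · exact absurd ((mD y').2 (Or.inr h)) hC'.2.1
      subst hyy
      have hya : y' ≠ a := by
        rintro rfl
        refine hAC (Vertex.eq_of_subset fun z hz => ?_)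
        rw [mC, mB]
        by_cases hza : z = y'
        · exact Or.inl hza
        · exact Or.inr ⟨fun e => hl.2.1 (e ▸ hz), Or.inr ⟨hza, hz⟩⟩
      have hyA : y' ∉ A.1.1 := fun h => hC.2.1 ((mB y').2 (Or.inr ⟨hya, h⟩))
      have hay : Far s a y' := by
        by_contra hf
        refine hAC' ⟨a, y', hl.1, hyA, hf, ?_⟩
        ext z
        have hza' : z ∈ A.1.1 → z ≠ q := fun h e => hl.2.1 (e ▸ h)
        rw [Finset.mem_insert, Finset.mem_erase, mC, mB]
        tauto
      obtain ⟨p, hp⟩ : (A.1.1.erase a).Nonempty := by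
        apply Finset.card_pos.1
        rw [Finset.card_erase_of_mem hl.1, A.1.2]; omega
      obtain ⟨hpa, hpA⟩ := Finset.mem_erase.1 hp
      have hpB : p ∈ B.1.1 := (mB p).2 (Or.inr ⟨hpa, hpA⟩)
      have hpD : p ∈ D.1.1 := (mD p).2 (Or.inr ⟨hpa, hpA⟩)
      have hpq : p ≠ q := fun e => hl.2.1 (e ▸ hpA)
      have hpC : p ∈ C.1.1 := (mC p).2 (Or.inr ⟨hpq, hpB⟩)
      have f1 := A.far hpA hl.1 hpa
      have f2 := B.far hpB haB' hpq
      have f3 := D.far hpD heD' fun e => hD.2.1 (e ▸ hpA)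
      have f4 := C.far hpC hyC fun e => hyA (e ▸ hpA)
      have c1 := hl.2.2.1
      have c2 := hD.2.2.1
      have c3 := hC.2.2.1
      have c4 := hC'.2.2.1
      clear mB mD mC mC'
      obtain ⟨p, -, -, rfl⟩ := exists_pt 0 p
      obtain ⟨a, l1, r1, rfl⟩ := exists_pt p a
      obtain ⟨q, l2, r2, rfl⟩ := exists_pt p q
      obtain ⟨r, l3, r3, rfl⟩ := exists_pt p r
      obtain ⟨y, l4, r4, rfl⟩ := exists_pt p y'
      rw [far_pt l1 (by omega)] at f1
      rw [far_pt l2 (by omega)] at f2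
      rw [far_pt l3 (by omega)] at f3
      rw [far_pt l4 (by omega)] at f4
      have key : ∀ {b c : ℤ}, p + s ≤ b → b + s ≤ p + n → p + s ≤ c → c + s ≤ p + n →
          (Far s (pt n b) (pt n c) ↔ b + s ≤ c ∨ c + s ≤ b) := by
        intro b c h1 h2 h3 h4
        rcases le_total b c with h | h
        · rw [far_pt h (by omega)]; omega
        · constructor
          · intro h'; have := (far_pt h (by omega)).1 h'.symm; omega
          · intro h'; exact ((far_pt h (by omega)).2 (by omega)).symm
      rw [key (by omega) (by omega) (by omega) (by omega)] at c1 c2 c3 c4 hay hfar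
      omega
    · have hqA : q ≠ a ∧ q ∈ A.1.1 := by
        rcases (mB q).1 hC.1 with h | h
        · exact absurd h hq
        · exact h
      have hqD : q ∈ D.1.1 := (mD q).2 (Or.inr hqA)
      have hqe : q ≠ e' := fun e => hD.2.1 (e ▸ hqA.2)
      have hqC : q ∉ C.1.1 := hC.symm.2.1
      have hr : r = q := by
        by_contra hr
        exact hqC ((mC' q).2 (Or.inr ⟨fun e => hr e.symm, hqD⟩))
      have he'C : e' ∈ C.1.1 := (mC' e').2 (Or.inr ⟨hr ▸ hqe.symm, heD'⟩)
      rcases (mC e').1 he'C with h | ⟨-, h⟩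
      · exact hC.2.2.1 (h ▸ D.far hqD heD' hqe)
      · rcases (mB e').1 h with h | h
        · exact hne h.symm
        · exact hD.2.1 h.2
  · have haD : a ∈ D.1.1 := (mD a).2 (Or.inr ⟨hae, hl.1⟩)
    have heB : e ∈ B.1.1 := (mB e).2 (Or.inr ⟨fun h => hae h.symm, hD.1⟩)
    have hne : a' ≠ e' := by
      rintro rfl
      exact hl.2.2.1 (D.far haD heD' hl.ne_points)
    have he'B : e' ∉ B.1.1 := by
      rw [mB]
      rintro (h | h)
      · exact hne h.symm
      · exact hD.2.1 h.2
    have ha'D : a' ∉ D.1.1 := by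
      rw [mD]
      rintro (h | h)
      · exact hne h
      · exact hl.2.1 h.2
    by_cases haC : a ∈ C.1.1
    · exfalso
      have hya : a = y := by
        rcases (mC a).1 haC with h | h
        · exact h
        · exact absurd h.2 haB
      have ha'C : a' ∉ C.1.1 := fun h => hl.2.2.1 (C.far haC h hl.ne_points)
      have hq : q = a' := by
        by_contra hq
        exact ha'C ((mC a').2 (Or.inr ⟨fun e => hq e.symm, haB'⟩))
      subst hya hq
      refine hAC (Vertex.eq_of_subset fun z hz => ?_).symm
      rcases (mC z).1 hz with rfl | ⟨h1, h2⟩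
      · exact hl.1
      · rcases (mB z).1 h2 with h | h
        · exact absurd h h1
        · exact h.2
    · have hr : r = a := by
        by_contra hr
        exact haC ((mC' a).2 (Or.inr ⟨fun e => hr e.symm, haD⟩))
      have he'C : e' ∈ C.1.1 :=
        (mC' e').2 (Or.inr ⟨fun h => hD.2.1 (h.trans hr ▸ hl.1), heD'⟩)
      have heC : e ∉ C.1.1 := fun h => hD.2.2.1 (C.far h he'C hD.ne_points)
      have hq : q = e := by
        by_contra hq
        exact heC ((mC e).2 (Or.inr ⟨fun h => hq h.symm, heB⟩))
      have ha'C : a' ∈ C.1.1 :=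
        (mC a').2 (Or.inr ⟨fun h => hl.2.1 (h.trans hq ▸ hD.1), haB'⟩)
      have hy : a' = y' := by
        rcases (mC' a').1 ha'C with h | h
        · exact h
        · exact absurd h.2 ha'D
      rw [hy, ← hr]
      exact hC'

end Squares

/-! ### Labels of unit moves -/

section Labels

variable {n k s : ℕ}

/-- Induction on admissible sequences starting at `a` whose later terms are at least `b`: lowering
one later term by one at a time leads to the sequence `a, b, b + s, b + 2s, …`. -/
theorem Adm.descend {a b : ℤ} (hb : a + s ≤ b) (P : (ℕ → ℤ) → Prop)
    (h0 : ∀ f, Adm n k s f → f 0 = a → (∀ i, 0 < i → i < k → f i = b + ((i : ℤ) - 1) * s) → P f)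
    (hstep : ∀ f i, Adm n k s f → f 0 = a → 0 < i → i < k →
      Adm n k s (Function.update f i (f i - 1)) → b ≤ f i - 1 →
      P (Function.update f i (f i - 1)) → P f)
    (f : ℕ → ℤ) (hf : Adm n k s f) (hf0 : f 0 = a) (hfb : ∀ i, 0 < i → i < k → b ≤ f i) : P f := by
  obtain ⟨N, hN⟩ : ∃ N : ℕ, ∑ i ∈ Finset.range k, (f i - a).toNat = N := ⟨_, rfl⟩
  induction N using Nat.strong_induction_on generalizing f with
  | _ N ih =>
    by_cases hm : ∃ i, 0 < i ∧ i < k ∧ b ≤ f i - 1 ∧ (1 < i → f (i - 1) + s < f i)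
    · obtain ⟨i, hi0, hik, hbi, hi⟩ := hm
      have hadm : Adm n k s (Function.update f i (f i - 1)) := by
        intro l j hlj hj
        have h1 := hf l j hlj hj
        have h2 := hf 0 j (by omega) hj
        simp only [Function.update_apply]
        have h3 : j = i → f l + s ≤ f i - 1 := by
          rintro rfl
          by_cases hj1 : 1 < j
          · have := hi hj1
            rcases Nat.lt_or_ge l (j - 1) with hl | hl
            · have := hf l (j - 1) hl (by omega); omega
            · have : l = j - 1 := by omega
              subst this; omega
          · have : l = 0 := by omega
            subst this; omega
        by_cases e1 : j = i <;> by_cases e2 : l = i <;> simp only [e1, e2, if_true, if_false]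
        · omega
        · have := h3 e1; subst e1; omega
        · subst e2; omega
        · omega
      refine hstep f i hf hf0 hi0 hik hadm hbi (ih _ ?_ _ hadm ?_ ?_ rfl)
      · rw [← hN]
        apply Finset.sum_lt_sum
        · intro j _
          simp only [Function.update_apply]
          split_ifs with e
          · subst e; omega
          · exact le_rfl
        · exact ⟨i, by simpa using hik, by simp; omega⟩
      · rw [Function.update_of_ne (by omega)]; exact hf0
      · intro j hj0 hj
        simp only [Function.update_apply]
        split_ifs
        · exact hbi
        · exact hfb j hj0 hj
    · push Not at hm
      refine h0 f hf hf0 fun i hi0 hik => ?_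
      induction i with
      | zero => omega
      | succ i ihi =>
        have h1 := hfb (i + 1) hi0 hik
        rcases Nat.eq_zero_or_pos i with rfl | hi
        · rw [zero_add] at h1
          by_contra hne
          have := hm 1 (by omega) hik (by simp at hne; omega)
          omega
        · have h2 := ihi hi (by omega)
          have h3 := hf i (i + 1) (by omega) hik
          have h4 := hfb i hi (by omega)
          by_contra hne
          have h5 := hm (i + 1) hi0 hik
          simp only [add_tsub_cancel_right] at h5
          have h6 : f (i + 1) ≤ f i + s := by
            by_contra hlt
            exact absurd (h5 (by omega)).2 (by omega)
          apply hne
          have : f (i + 1) = f i + s := by omega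
          rw [this, h2]; push_cast; ring

theorem not_move_of_two {v u : Vertex n k s} {p q : Fin n} (hpq : p ≠ q) (hp : p ∈ v.1.1)
    (hq : q ∈ v.1.1) (hp' : p ∉ u.1.1) (hq' : q ∉ u.1.1) : v ≠ u ∧ ¬ Move v u := by
  refine ⟨fun e => hp' (e ▸ hp), ?_⟩
  rintro ⟨x, y, h⟩
  rw [h.mem_iff] at hp' hq'
  have h1 : p = x := by tauto
  have h2 : q = x := by tauto
  exact hpq (h1.trans h2.symm)

/-- The sequence `c, b + s, b + 2s, …`. -/
def tightSeq (s : ℕ) (c b : ℤ) (i : ℕ) : ℤ := if i = 0 then c else b + i * s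

theorem tightSeq_adm {c b : ℤ} (h1 : c ≤ b) (h2 : b + k * s ≤ c + n) :
    Adm n k s (tightSeq s c b) := by
  intro i j hij hj
  have e1 : ((i : ℤ) + 1) * s ≤ j * s := mul_le_mul_of_nonneg_right (by omega) (by omega)
  have e2 : ((j : ℤ) + 1) * s ≤ k * s := mul_le_mul_of_nonneg_right (by omega) (by omega)
  have e3 : (0 : ℤ) ≤ i * s := by positivity
  have e4 : (i : ℤ) = 0 → (i : ℤ) * s = 0 := fun h => by rw [h, zero_mul]
  rw [add_mul, one_mul] at e1 e2
  have hj0 : j ≠ 0 := by omega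
  simp only [tightSeq, hj0, if_false]
  split_ifs with hi
  · have := e4 (by exact_mod_cast hi); omega
  · omega

variable [NeZero n]

theorem ofSeq_congr {hs : 1 ≤ s} {f g : ℕ → ℤ} {hf : Adm n k s f} {hg : Adm n k s g}
    (h : ∀ i < k, f i = g i) : ofSeq hs f hf = ofSeq hs g hg := by
  apply Vertex.eq_of_subset
  intro z hz
  obtain ⟨i, hi, rfl⟩ := mem_ofSeq.1 hz
  rw [h i hi]
  exact mem_ofSeq.2 ⟨i, hi, rfl⟩

/-- An automorphism maps all moves `a → a + 1` to moves of one and the same element to one and the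
same point: two such moves are joined by squares that lower the other elements step by step. -/
theorem exists_label_seq (hk : 2 ≤ k) (hs : 2 ≤ s) (hn : k * s + 1 ≤ n)
    (φ : stableKneserGraph n k s ≃g stableKneserGraph n k s) (hs1 : 1 ≤ s) (a : ℤ) :
    ∃ x y, ∀ (f g : ℕ → ℤ) (hf : Adm n k s f) (hg : Adm n k s g), f 0 = a → g 0 = a + 1 →
      (∀ j < k, j ≠ 0 → g j = f j) → MoveAt (φ (ofSeq hs1 f hf)) (φ (ofSeq hs1 g hg)) x y := by
  have hks : 2 * s ≤ k * s := Nat.mul_le_mul_right s hk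
  have hn' : (k : ℤ) * s + 1 ≤ n := by exact_mod_cast hn
  have hns : 2 * s ≤ n := by omega
  have ht : Adm n k s (tightSeq s a (a + 1)) := tightSeq_adm (by omega) (by omega)
  have ht' : Adm n k s (tightSeq s (a + 1) (a + 1)) := tightSeq_adm (by omega) (by omega)
  obtain ⟨x, y, hxy⟩ : Move (φ (ofSeq hs1 _ ht)) (φ (ofSeq hs1 _ ht')) := by
    rw [move_map hk hs hns]
    exact ⟨_, _, moveAt_ofSeq hs1 (by omega) (i := 0) ht ht' (by omega)
      (fun j _ hj => by simp [tightSeq, hj]) (by simp [tightSeq]) (by simp [tightSeq]; omega)⟩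
  refine ⟨x, y, fun f g hf hg hf0 hg0 hfg => ?_⟩
  refine Adm.descend (n := n) (k := k) (a := a) (b := a + 1 + s) (by omega)
    (fun f => ∀ (hf : Adm n k s f) (g : ℕ → ℤ) (hg : Adm n k s g), g 0 = a + 1 →
      (∀ j < k, j ≠ 0 → g j = f j) → MoveAt (φ (ofSeq hs1 f hf)) (φ (ofSeq hs1 g hg)) x y)
    ?_ ?_ f hf hf0 ?_ hf g hg hg0 hfg
  · intro f _ hf0 hft hf g hg hg0 hfg
    have e : ∀ i, i ≠ 0 → i < k → f i = a + 1 + i * s := by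
      intro i hi hik
      rw [hft i (by omega) hik]; ring
    rw [ofSeq_congr (f := f) (hg := ht), ofSeq_congr (f := g) (hg := ht')]
    · exact hxy
    · intro i hi
      by_cases h : i = 0
      · simp [h, tightSeq, hg0]
      · simp [tightSeq, h, hfg i hi h, e i h hi]
    · intro i hi
      by_cases h : i = 0
      · simp [h, tightSeq, hf0]
      · simp [tightSeq, h, e i h hi]
  · intro f i _ hf0 hi0 hik hu hb ih hf g hg hg0 hfg
    have hgi : g i = f i := hfg i hik (by omega)
    have hu' : Adm n k s (Function.update g i (f i - 1)) := by
      intro l j hlj hj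
      have h1 := hu l j hlj hj
      have h2 := hg l j hlj hj
      have h3 := hfg j hj (by omega)
      have h4 := hfg l (by omega)
      simp only [Function.update_apply] at h1 ⊢
      by_cases e1 : j = i <;> by_cases e2 : l = i <;>
        simp only [e1, e2, if_true, if_false] at h1 ⊢
      · omega
      · by_cases hl : l = 0
        · subst hl; omega
        · have := h4 hl; omega
      · omega
      · omega
    have hi0' : (0 : ℕ) ≠ i := by omega
    have hlab := ih hu _ hu' (by rw [Function.update_of_ne hi0']; exact hg0) (by
      intro j hj hj0
      simp only [Function.update_apply]
      split_ifs
      · rfl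
      · exact hfg j hj hj0)
    have mgf : Move (ofSeq hs1 _ hu) (ofSeq hs1 f hf) :=
      ⟨_, _, moveAt_ofSeq hs1 (by omega) (i := i) hu hf hik
        (fun j _ hj => by rw [Function.update_of_ne hj]) (by simp) (by simp; omega)⟩
    have mgf' : Move (ofSeq hs1 _ hu') (ofSeq hs1 g hg) :=
      ⟨_, _, moveAt_ofSeq hs1 (by omega) (i := i) hu' hg hik
        (fun j _ hj => by rw [Function.update_of_ne hj]) (by simp; omega) (by simp; omega)⟩
    have mfg : Move (ofSeq hs1 f hf) (ofSeq hs1 g hg) :=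
      ⟨_, _, moveAt_ofSeq hs1 (by omega) (i := 0) hf hg (by omega)
        (fun j hj hj0 => hfg j hj hj0) (by omega) (by omega)⟩
    have m1 : ∀ {h : ℕ → ℤ} {hh : Adm n k s h} {j : ℕ}, j < k → pt n (h j) ∈ (ofSeq hs1 h hh).1.1 :=
      fun hj => mem_ofSeq.2 ⟨_, hj, rfl⟩
    have fi := hf 0 i hi0 hik
    have gi := hg 0 i hi0 hik
    have hk0 : 0 < k := by omega
    have memf0 : pt n a ∈ (ofSeq hs1 f hf).1.1 := hf0 ▸ m1 (hh := hf) hk0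
    have memg0 : pt n (a + 1) ∈ (ofSeq hs1 g hg).1.1 := hg0 ▸ m1 (hh := hg) hk0
    have memfi : pt n (f i) ∈ (ofSeq hs1 f hf).1.1 := m1 (hh := hf) hik
    have memgi : pt n (f i) ∈ (ofSeq hs1 g hg).1.1 := hgi ▸ m1 (hh := hg) hik
    have memu0 : pt n a ∈ (ofSeq hs1 _ hu).1.1 := by
      have := m1 (hh := hu) hk0
      rwa [Function.update_of_ne hi0', hf0] at this
    have memu0' : pt n (a + 1) ∈ (ofSeq hs1 _ hu').1.1 := by
      have := m1 (hh := hu') hk0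
      rwa [Function.update_of_ne hi0', hg0] at this
    have memui : pt n (f i - 1) ∈ (ofSeq hs1 _ hu).1.1 := by
      have := m1 (hh := hu) hik
      rwa [Function.update_self] at this
    have memui' : pt n (f i - 1) ∈ (ofSeq hs1 _ hu').1.1 := by
      have := m1 (hh := hu') hik
      rwa [Function.update_self] at this
    have nc : ∀ (v : Vertex n k s) {p q : ℤ}, pt n p ∈ v.1.1 → p < q → q < p + s →
        pt n q ∉ v.1.1 := fun v p q h1 h3 h4 h2 => v.not_close (by omega) h1 h2 h3 h4
    have nc' : ∀ (v : Vertex n k s) {p q : ℤ}, pt n q ∈ v.1.1 → p < q → q < p + s →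
        pt n p ∉ v.1.1 := fun v p q h2 h3 h4 h1 => v.not_close (by omega) h1 h2 h3 h4
    have d1 := not_move_of_two (v := ofSeq hs1 _ hu) (u := ofSeq hs1 g hg)
      (p := pt n a) (q := pt n (f i - 1))
      (fun e => by have := pt_injOn e (by omega) (by omega); omega)
      memu0 memui (nc' _ memg0 (by omega) (by omega)) (nc' _ memgi (by omega) (by omega))
    have d2 := not_move_of_two (v := ofSeq hs1 _ hu') (u := ofSeq hs1 f hf)
      (p := pt n (a + 1)) (q := pt n (f i - 1))
      (fun e => by have := pt_injOn e (by omega) (by omega); omega)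
      memu0' memui' (nc _ memf0 (by omega) (by omega)) (nc' _ memfi (by omega) (by omega))
    exact square_moveAt hk ((move_map hk hs hns φ).2 mgf') ((move_map hk hs hns φ).2 mfg)
      ((move_map hk hs hns φ).2 mgf) (fun e => d1.1 (φ.injective e)) (fun e => d2.1 (φ.injective e))
      (fun e => d1.2 ((move_map hk hs hns φ).1 e)) (fun e => d2.2 ((move_map hk hs hns φ).1 e)) hlab
  · intro i hi0 hik
    have := hg 0 i hi0 hik
    rw [hg0, hfg i hik (by omega)] at this
    omega

/-- If the element `a` of `v` can be moved to `a + d`, then it can be moved to every position in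
between; here `v` is listed from that element. -/
theorem exists_seq_of_moveAt (hns : 2 * s ≤ n) (hs1 : 1 ≤ s) {v u : Vertex n k s} {a d : ℤ}
    (h1 : 1 ≤ d) (h2 : d < s) (h : MoveAt v u (pt n a) (pt n (a + d))) :
    ∃ (f : ℕ → ℤ) (hf : Adm n k s f), f 0 = a ∧ v = ofSeq hs1 f hf ∧
      ∀ c, a ≤ c → c ≤ a + d → ∃ hg : Adm n k s (Function.update f 0 c),
        (c = a + d → u = ofSeq hs1 _ hg) := by
  obtain ⟨f, hf, hf0, hv⟩ := exists_ofSeq hs1 v h.1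
  refine ⟨f, hf, hf0, hv, fun c hc1 hc2 => ?_⟩
  have hfar : ∀ j, 0 < j → j < k → a + d + s ≤ f j := by
    intro j hj0 hj
    have hfj := hf 0 j hj0 hj
    have hjv : pt n (f j) ∈ v.1.1 := by rw [hv]; exact mem_ofSeq.2 ⟨j, hj, rfl⟩
    have hja : pt n (f j) ≠ pt n a := fun e => by
      have := pt_injOn e (by omega) (by omega); omega
    have hju : pt n (f j) ∈ u.1.1 := (h.mem_iff _).2 (Or.inr ⟨hja, hjv⟩)
    have hne : pt n (a + d) ≠ pt n (f j) := fun e => h.2.1 (e ▸ hjv)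
    rcases le_total (a + d) (f j) with hle | hle
    · exact ((far_pt hle (by omega)).1 (u.far h.symm.1 hju hne)).1
    · have := (far_pt hle (by omega)).1 (u.far hju h.symm.1 hne.symm)
      omega
  have hg : Adm n k s (Function.update f 0 c) := by
    intro i j hij hj
    have e1 := hf i j hij hj
    have e2 := hfar j (by omega) hj
    rw [Function.update_of_ne (show j ≠ 0 by omega)]
    by_cases hi : i = 0
    · subst hi; simp only [Function.update_self]; omega
    · rw [Function.update_of_ne hi]; exact e1
  refine ⟨hg, ?_⟩
  rintro rfl
  have hk : 0 < k := by rw [← v.1.2]; exact Finset.card_pos.2 ⟨_, h.1⟩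
  have hm := moveAt_ofSeq hs1 (by omega) (i := 0) hf hg hk
    (fun j _ hj => by rw [Function.update_of_ne hj]) (by simp; omega) (by simp; omega)
  simp only [Function.update_self, hf0] at hm
  rw [← hv] at hm
  apply Vertex.ext
  rw [hm.2.2.2, h.2.2.2]

theorem exists_label (hk : 2 ≤ k) (hs : 2 ≤ s) (hn : k * s + 1 ≤ n)
    (φ : stableKneserGraph n k s ≃g stableKneserGraph n k s) (z : Fin n) :
    ∃ x y, ∀ v u, MoveAt v u z (finRotate n z) → MoveAt (φ v) (φ u) x y := by
  have hks : 2 * s ≤ k * s := Nat.mul_le_mul_right s hk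
  obtain ⟨a, -, -, rfl⟩ := exists_pt 0 z
  rw [finRotate_pt]
  obtain ⟨x, y, h⟩ := exists_label_seq hk hs hn φ (by omega) a
  refine ⟨x, y, fun v u hvu => ?_⟩
  obtain ⟨f, hf, hf0, hv, hg⟩ :=
    exists_seq_of_moveAt (by omega) (by omega) le_rfl (by omega) hvu
  obtain ⟨hg, hu⟩ := hg (a + 1) (by omega) (by omega)
  rw [hv, hu rfl]
  exact h f _ hf hg hf0 (by simp) fun j _ hj => by rw [Function.update_of_ne hj]

end Labels

/-! ### The permutation of the points induced by an automorphism -/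

section PointMap

variable {n k s : ℕ}

/-- Two moves of the same element combine into one. -/
theorem MoveAt.trans {A B C : Vertex n k s} {p q r : Fin n} (h1 : MoveAt A B p q)
    (h2 : MoveAt B C q r) (h : Move A C) : MoveAt A C p r := by
  obtain ⟨x, y, hxy⟩ := h
  have m1 := h1.mem_iff
  have m2 := h2.mem_iff
  have hrp : r ≠ p := by
    rintro rfl
    refine hxy.ne (Vertex.eq_of_subset fun z hz => ?_)
    rw [m2, m1]
    by_cases hzr : z = r
    · exact Or.inl hzr
    · exact Or.inr ⟨fun e => h1.2.1 (e ▸ hz), Or.inr ⟨hzr, hz⟩⟩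
  refine hxy.of_eq h1.1 (fun hr => h2.2.1 ((m1 r).2 (Or.inr ⟨hrp, hr⟩))) ?_
  ext z
  rw [Finset.mem_insert, Finset.mem_erase, m2, m1]
  have : z ∈ A.1.1 → z ≠ q := fun h e => h1.2.1 (e ▸ h)
  tauto

variable [NeZero n]

/-- If `d < s` and `n ≥ ks + d`, some vertex admits the move `a → a + d`. -/
theorem exists_moveAt (hk : 2 ≤ k) (hs : 2 ≤ s) {d : ℤ} (h1 : 1 ≤ d) (h2 : d < s)
    (hn : (k : ℤ) * s + d ≤ n) (a : ℤ) :
    ∃ v u : Vertex n k s, MoveAt v u (pt n a) (pt n (a + d)) := by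
  have hks : (2 : ℤ) * s ≤ k * s := mul_le_mul_of_nonneg_right (by omega) (by omega)
  have ht : Adm n k s (tightSeq s a (a + d)) := tightSeq_adm (by omega) (by omega)
  have ht' : Adm n k s (tightSeq s (a + d) (a + d)) := tightSeq_adm (by omega) (by omega)
  have h := moveAt_ofSeq (show 1 ≤ s by omega) (by omega) (i := 0) ht ht' (by omega)
    (fun j _ hj => by simp [tightSeq, hj]) (by simp [tightSeq]; omega) (by simp [tightSeq]; omega)
  simp only [tightSeq, if_true] at h
  exact ⟨_, _, h⟩

/-- With two steps of room, the labels of consecutive unit moves fit together: if an element moves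
from `a` to `a + 1` and on to `a + 2`, then some vertex avoids the first and the last position but
not the middle one, which fails for two moves of different elements. -/
theorem exists_pointMap (hk : 2 ≤ k) (hs : 2 ≤ s) (hn : k * s + 2 ≤ n)
    (φ : stableKneserGraph n k s ≃g stableKneserGraph n k s) :
    ∃ π : Fin n → Fin n, ∀ z v u, MoveAt v u z (finRotate n z) →
      MoveAt (φ v) (φ u) (π z) (π (finRotate n z)) := by
  have hks : 2 * s ≤ k * s := Nat.mul_le_mul_right s hk
  have hn' : (k : ℤ) * s + 2 ≤ n := by exact_mod_cast hn
  choose X Y hXY using exists_label hk hs (show k * s + 1 ≤ n by omega) φ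
  suffices h : ∀ z, Y z = X (finRotate n z) from
    ⟨X, fun z v u hvu => h z ▸ hXY z v u hvu⟩
  intro z
  obtain ⟨a, -, -, rfl⟩ := exists_pt 0 z
  have hs1 : 1 ≤ s := by omega
  have ht : ∀ c, a ≤ c → c ≤ a + 2 → Adm n k s (tightSeq s c (a + 2)) := fun c h1 h2 =>
    tightSeq_adm (by omega) (by omega)
  have hmv : ∀ c (h1 : a ≤ c) (h2 : c + 1 ≤ a + 2),
      MoveAt (ofSeq hs1 _ (ht c h1 (by omega))) (ofSeq hs1 _ (ht (c + 1) (by omega) h2))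
        (pt n c) (finRotate n (pt n c)) := by
    intro c h1 h2
    have h := moveAt_ofSeq hs1 (by omega) (i := 0) (ht c h1 (by omega)) (ht (c + 1) (by omega) h2)
      (by omega) (fun j _ hj => by simp [tightSeq, hj]) (by simp [tightSeq])
      (by simp [tightSeq]; omega)
    rw [finRotate_pt]
    simpa only [tightSeq, if_true] using h
  obtain ⟨v0, v1, v2, m01, m12⟩ : ∃ v0 v1 v2 : Vertex n k s,
      MoveAt v0 v1 (pt n a) (finRotate n (pt n a)) ∧
      MoveAt v1 v2 (pt n (a + 1)) (finRotate n (pt n (a + 1))) :=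
    ⟨_, _, _, hmv a le_rfl (by omega), hmv (a + 1) (by omega) (by omega)⟩
  have l01 := hXY _ _ _ m01
  have l12 := hXY _ _ _ m12
  rw [finRotate_pt] at m01 m12 ⊢
  by_contra hne
  have w0 : Disjoint (rotateV 1 v0).1.1 v0.1.1 :=
    rotateV_disjoint (by omega) v0 le_rfl (by omega)
  have w2 : Disjoint (rotateV 1 v0).1.1 v2.1.1 := by
    apply disjoint_of_pt
    intro b hb hb2
    rcases (m12.mem_iff _).1 hb2 with e | ⟨e, hb1⟩
    · rw [mem_rotateV, sub_eq_add_neg, pt_add_congr e (-1)] at hb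
      exact v0.not_close (by omega) m01.1 hb (by omega) (by omega)
    · rcases (m01.mem_iff _).1 hb1 with e' | ⟨-, hb0⟩
      · exact e e'
      · exact Finset.disjoint_left.1 w0 hb hb0
  have w1 : ¬ Disjoint (rotateV 1 v0).1.1 v1.1.1 :=
    Finset.not_disjoint_iff.2 ⟨pt n (a + 1), (mem_rotateV _ _ _).2 (by simpa using m01.1),
      m01.symm.1⟩
  have hk1 : 1 ≤ k := by omega
  rw [← adj_iff hk1, ← φ.map_adj_iff, adj_iff hk1] at w0 w1 w2
  refine w1 (Finset.disjoint_left.2 fun t ht ht1 => ?_)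
  rcases (l01.mem_iff t).1 ht1 with rfl | h
  · exact Finset.disjoint_left.1 w2 ht ((l12.mem_iff _).2 (Or.inr ⟨hne, ht1⟩))
  · exact Finset.disjoint_left.1 w0 ht h.2

/-- A map that describes the effect of an automorphism on unit moves describes it on all moves. -/
theorem pointMap_moveAt (hk : 2 ≤ k) (hs : 2 ≤ s) (hns : 2 * s ≤ n)
    {φ : stableKneserGraph n k s ≃g stableKneserGraph n k s} {π : Fin n → Fin n}
    (hπ : ∀ z v u, MoveAt v u z (finRotate n z) →
      MoveAt (φ v) (φ u) (π z) (π (finRotate n z)))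
    {v u : Vertex n k s} {x y : Fin n} (h : MoveAt v u x y) :
    MoveAt (φ v) (φ u) (π x) (π y) := by
  have hs1 : 1 ≤ s := by omega
  have fwd : ∀ {v u : Vertex n k s} {a d : ℤ}, 1 ≤ d → d < s →
      MoveAt v u (pt n a) (pt n (a + d)) →
      MoveAt (φ v) (φ u) (π (pt n a)) (π (pt n (a + d))) := by
    intro v u a d h1 h2 h
    obtain ⟨f, hf, hf0, hv, hF⟩ := exists_seq_of_moveAt hns hs1 h1 h2 h
    have mv : ∀ c, a < c → c ≤ a + d → ∀ hg : Adm n k s (Function.update f 0 c),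
        MoveAt v (ofSeq hs1 _ hg) (pt n a) (pt n c) := by
      intro c hc1 hc2 hg
      have := moveAt_ofSeq hs1 (by omega) (i := 0) hf hg (by omega)
        (fun j _ hj => by rw [Function.update_of_ne hj]) (by simp; omega) (by simp; omega)
      rw [← hv] at this
      simpa only [Function.update_self, hf0] using this
    have key : ∀ j : ℕ, 1 ≤ j → (j : ℤ) ≤ d → ∀ hg : Adm n k s (Function.update f 0 (a + j)),
        MoveAt (φ v) (φ (ofSeq hs1 _ hg)) (π (pt n a)) (π (pt n (a + j))) := by
      intro j hj
      induction j, hj using Nat.le_induction with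
      | base =>
        intro _ hg
        have := mv _ (by omega) (by omega) hg
        push_cast at this ⊢
        rw [← finRotate_pt] at this ⊢
        exact hπ _ _ _ this
      | succ j hj ih =>
        intro hjd hg
        push_cast at hjd
        obtain ⟨hg', -⟩ := hF (a + j) (by omega) (by omega)
        have h01 := ih (by omega) hg'
        have h12 := moveAt_ofSeq hs1 (by omega) (i := 0) hg' hg (by omega)
          (fun i _ hi => by rw [Function.update_of_ne hi, Function.update_of_ne hi]) (by simp)
          (by simp; omega)
        have e : a + ((j + 1 : ℕ) : ℤ) = a + j + 1 := by push_cast; ring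
        simp only [Function.update_self] at h12
        have h02 := mv _ (by push_cast; omega) (by push_cast; omega) hg
        have h12' := hπ _ _ _ (by rw [finRotate_pt, ← e]; exact h12)
        rw [finRotate_pt, ← e] at h12'
        exact h01.trans h12' ((move_map hk hs hns φ).2 ⟨_, _, h02⟩)
    obtain ⟨hg, hu⟩ := hF (a + d) (by omega) le_rfl
    rw [hu rfl]
    obtain ⟨j, rfl⟩ : ∃ j : ℕ, d = j := ⟨d.toNat, by omega⟩
    exact key j (by omega) le_rfl hg
  obtain ⟨a, d, h1, h2, ⟨rfl, rfl⟩ | ⟨rfl, rfl⟩⟩ := h.coords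
  · exact fwd h1 h2 h
  · exact (fwd h1 h2 h.symm).symm

/-- The point maps of an automorphism and of its inverse are inverse to each other. -/
theorem exists_pointPerm (hk : 2 ≤ k) (hs : 2 ≤ s) (hn : k * s + 2 ≤ n)
    (φ : stableKneserGraph n k s ≃g stableKneserGraph n k s) :
    ∃ π : Equiv.Perm (Fin n),
      (∀ v u x y, MoveAt v u x y → MoveAt (φ v) (φ u) (π x) (π y)) ∧
      (∀ v u x y, MoveAt v u x y → MoveAt (φ.symm v) (φ.symm u) (π.symm x) (π.symm y)) := by
  have hks : 2 * s ≤ k * s := Nat.mul_le_mul_right s hk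
  have hn' : (k : ℤ) * s + 2 ≤ n := by exact_mod_cast hn
  obtain ⟨π, hπ⟩ := exists_pointMap hk hs hn φ
  obtain ⟨ρ, hρ⟩ := exists_pointMap hk hs hn φ.symm
  have hπ' := fun v u x y => pointMap_moveAt hk hs (by omega) hπ (v := v) (u := u) (x := x) (y := y)
  have hρ' := fun v u x y => pointMap_moveAt hk hs (by omega) hρ (v := v) (u := u) (x := x) (y := y)
  have inv1 : ∀ x, ρ (π x) = x := by
    intro x
    obtain ⟨a, -, -, rfl⟩ := exists_pt 0 x
    obtain ⟨v, u, h⟩ := exists_moveAt (n := n) hk hs (d := 1) le_rfl (by omega) (by omega) a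
    have h' := hρ' _ _ _ _ (hπ' _ _ _ _ h)
    rw [φ.symm_apply_apply, φ.symm_apply_apply] at h'
    exact (h'.unique h).1
  have inv2 : ∀ x, π (ρ x) = x := by
    intro x
    obtain ⟨a, -, -, rfl⟩ := exists_pt 0 x
    obtain ⟨v, u, h⟩ := exists_moveAt (n := n) hk hs (d := 1) le_rfl (by omega) (by omega) a
    have h' := hπ' _ _ _ _ (hρ' _ _ _ _ h)
    rw [φ.apply_symm_apply, φ.apply_symm_apply] at h'
    exact (h'.unique h).1
  exact ⟨⟨π, ρ, inv1, inv2⟩, hπ', hρ'⟩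

/-- A permutation of the points that describes the effect of `φ` on moves induces `φ`: this is
inherited from the vertices on which the element in question can be moved. -/
theorem mem_of_pointPerm (hk : 2 ≤ k) (hs : 2 ≤ s) (hn : k * s + 1 ≤ n)
    {φ : stableKneserGraph n k s ≃g stableKneserGraph n k s} {π : Equiv.Perm (Fin n)}
    (hπ : ∀ v u x y, MoveAt v u x y → MoveAt (φ v) (φ u) (π x) (π y))
    (v : Vertex n k s) {x : Fin n} (hx : x ∈ v.1.1) : π x ∈ (φ v).1.1 := by
  have hks : 2 * s ≤ k * s := Nat.mul_le_mul_right s hk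
  have hn' : (k : ℤ) * s + 1 ≤ n := by exact_mod_cast hn
  have hs1 : 1 ≤ s := by omega
  obtain ⟨a, -, -, rfl⟩ := exists_pt 0 x
  obtain ⟨f, hf, hf0, rfl⟩ := exists_ofSeq hs1 v hx
  refine Adm.descend (n := n) (k := k) (a := a) (b := a + s) le_rfl
    (fun f => ∀ hf : Adm n k s f, π (pt n a) ∈ (φ (ofSeq hs1 f hf)).1.1) ?_ ?_ f hf hf0 ?_ hf
  · intro f _ hf0 hft hf
    have ht : Adm n k s (tightSeq s (a - 1) a) := tightSeq_adm (by omega) (by omega)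
    have h := moveAt_ofSeq hs1 (by omega) (i := 0) ht hf (by omega)
      (fun j hj hj0 => by
        rw [hft j (by omega) hj]; simp only [tightSeq, hj0, if_false]; ring)
      (by simp [tightSeq]; omega) (by simp [tightSeq]; omega)
    rw [hf0] at h
    exact (hπ _ _ _ _ h).symm.1
  · intro f i _ hf0 hi0 hik hu hb ih hf
    have h := moveAt_ofSeq hs1 (by omega) (i := i) hu hf hik
      (fun j _ hj => by rw [Function.update_of_ne hj]) (by simp) (by simp; omega)
    rw [Function.update_self] at h
    refine ((hπ _ _ _ _ h).mem_iff _).2 (Or.inr ⟨fun e => ?_, ih hu⟩)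
    have hfi := hf 0 i hi0 hik
    have := pt_injOn (π.injective e) (by omega) (by omega)
    omega
  · intro i hi0 hik
    have := hf 0 i hi0 hik
    omega

end PointMap

/-! ### Permutations preserving proximity are dihedral -/

section Dihedral

variable {n s : ℕ} [NeZero n]

theorem not_far_coords {a : ℤ} {z : Fin n} (h : ¬ Far s (pt n a) z) :
    ∃ c, a - s < c ∧ c < a + s ∧ z = pt n c := by
  obtain ⟨c, h1, h2, rfl⟩ := exists_pt a z
  rw [far_pt h1 (by omega)] at h
  by_cases hc : c < a + s
  · exact ⟨c, by omega, hc, rfl⟩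
  · refine ⟨c - n, by omega, by omega, ?_⟩
    rw [← pt_add_n (c - n), sub_add_cancel]

/-- Neighbouring points of the cycle, described by proximity alone: `x` and `y` are distinct and
near to each other, and at most one point is near to `x` but far from `y`. If `x` and `y` are at
distance `d < s` on a cycle of length at least `3s - 2`, then there are `d` such points. -/
def Neighbours (s : ℕ) (x y : Fin n) : Prop :=
  x ≠ y ∧ ¬ Far s x y ∧ ∀ z z', ¬ Far s x z → Far s y z → ¬ Far s x z' → Far s y z' → z = z'

theorem neighbours_succ (hs : 2 ≤ s) (hn : 2 * s ≤ n) (a : ℤ) :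
    Neighbours s (pt n a) (pt n (a + 1)) := by
  refine ⟨fun e => ?_, ?_, ?_⟩
  · have := pt_injOn e (by omega) (by omega); omega
  · rw [far_pt (by omega) (by omega)]; omega
  · have key : ∀ z, ¬ Far s (pt n a) z → Far s (pt n (a + 1)) z → z = pt n (a - s + 1) := by
      intro z h1 h2
      obtain ⟨c, hc1, hc2, rfl⟩ := not_far_coords h1
      rcases le_total c (a + 1) with h | h
      · have := (far_pt h (by omega)).1 h2.symm
        congr 1; omega
      · have := (far_pt h (by omega)).1 h2
        omega
    intro z z' h1 h2 h3 h4
    rw [key z h1 h2, key z' h3 h4]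

theorem Neighbours.coords (hn : 3 * s ≤ n + 2) (hn2 : 2 * s ≤ n) {a : ℤ} {y : Fin n}
    (h : Neighbours s (pt n a) y) : y = pt n (a + 1) ∨ y = pt n (a - 1) := by
  obtain ⟨h1, h2, h3⟩ := h
  obtain ⟨c, hc1, hc2, rfl⟩ := not_far_coords h2
  have hca : c ≠ a := fun e => h1 (by rw [e])
  rcases lt_or_gt_of_ne hca with hlt | hlt
  · by_cases hc : c = a - 1
    · right; rw [hc]
    · exfalso
      have := h3 (pt n (a + s - 1)) (pt n (a + s - 2))
        (by rw [far_pt (by omega) (by omega)]; omega)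
        (by rw [far_pt (by omega) (by omega)]; omega)
        (by rw [far_pt (by omega) (by omega)]; omega)
        (by rw [far_pt (by omega) (by omega)]; omega)
      have := pt_injOn this (by omega) (by omega)
      omega
  · by_cases hc : c = a + 1
    · left; rw [hc]
    · exfalso
      have := h3 (pt n (a - s + 1)) (pt n (a - s + 2))
        (fun h => by have := (far_pt (by omega) (by omega)).1 h.symm; omega)
        (((far_pt (by omega) (by omega)).2 (by omega)).symm)
        (fun h => by have := (far_pt (by omega) (by omega)).1 h.symm; omega)
        (((far_pt (by omega) (by omega)).2 (by omega)).symm)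
      have := pt_injOn this (by omega) (by omega)
      omega

/-- A permutation that preserves proximity preserves neighbours, so it is a rotation or a
reflection of the cycle. -/
theorem perm_dihedral (hs : 2 ≤ s) (hn : 3 * s ≤ n + 2) (hn2 : 2 * s ≤ n) (π : Equiv.Perm (Fin n))
    (hπ : ∀ x y, Far s (π x) (π y) ↔ Far s x y) :
    ∃ b : ℤ, (∀ a, π (pt n a) = pt n (b + a)) ∨ ∀ a, π (pt n a) = pt n (b - a) := by
  have hnb : ∀ a, Neighbours s (π (pt n a)) (π (pt n (a + 1))) := by
    intro a
    obtain ⟨h1, h2, h3⟩ := neighbours_succ hs hn2 a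
    refine ⟨fun e => h1 (π.injective e), by rwa [hπ], fun z z' => ?_⟩
    obtain ⟨z, rfl⟩ := π.surjective z
    obtain ⟨z', rfl⟩ := π.surjective z'
    rw [hπ, hπ, hπ, hπ]
    intro e1 e2 e3 e4
    rw [h3 z z' e1 e2 e3 e4]
  obtain ⟨b, -, -, hb⟩ := exists_pt 0 (π (pt n 0))
  have ne2 : ∀ a : ℤ, pt n (a + 1 + 1) ≠ pt n a := fun a e => by
    have := pt_injOn e (by omega) (by omega); omega
  have hlift : ∀ g : ℤ → ℤ, (∀ c d, pt n c = pt n d → pt n (g c) = pt n (g d)) →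
      (∀ j : ℕ, π (pt n j) = pt n (g j)) → ∀ a, π (pt n a) = pt n (g a) := by
    intro g hg h a
    have h1 := Int.emod_nonneg a (n_pos_int (n := n)).ne'
    have e : pt n a = pt n ((a % (n : ℤ)).toNat : ℤ) := by
      rw [Int.toNat_of_nonneg h1, pt_eq_iff]; simp
    rw [e, h]
    exact (hg _ _ e).symm
  refine ⟨b, ?_⟩
  have h0 := hnb 0
  rw [← hb] at h0
  rcases h0.coords hn hn2 with h1 | h1
  · left
    apply hlift
    · intro c d e
      have := pt_add_congr e b
      rwa [add_comm c, add_comm d] at this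
    · have key : ∀ j : ℕ, π (pt n j) = pt n (b + j) ∧ π (pt n (j + 1)) = pt n (b + j + 1) := by
        intro j
        induction j with
        | zero => simpa using ⟨hb.symm, h1⟩
        | succ j ih =>
          have := hnb (j + 1)
          rw [ih.2] at this
          push_cast
          rw [← add_assoc]
          refine ⟨ih.2, ?_⟩
          rcases this.coords hn hn2 with e | e
          · exact e
          · rw [add_sub_cancel_right, ← ih.1] at e
            exact absurd (π.injective e) (ne2 _)
      exact fun j => (key j).1
  · right
    apply hlift
    · intro c d e
      exact pt_sub_congr e b
    · have key : ∀ j : ℕ, π (pt n j) = pt n (b - j) ∧ π (pt n (j + 1)) = pt n (b - j - 1) := by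
        intro j
        induction j with
        | zero => simpa using ⟨hb.symm, h1⟩
        | succ j ih =>
          have := hnb (j + 1)
          rw [ih.2] at this
          push_cast
          rw [← sub_sub]
          refine ⟨ih.2, ?_⟩
          rcases this.coords hn hn2 with e | e
          · rw [sub_add_cancel, ← ih.1] at e
            exact absurd (π.injective e) (ne2 _)
          · exact e
      exact fun j => (key j).1

end Dihedral

/-! ### Rotations and reflections -/

section RotationsReflections

variable {n k s : ℕ}

theorem not_isShift_of_mem (hk : 1 ≤ k) {φ : stableKneserGraph n k s ≃g stableKneserGraph n k s}
    {v : Vertex n k s} {x : Fin n} (h1 : x ∈ v.1.1) (h2 : x ∈ (φ v).1.1) : ¬ IsShift φ :=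
  fun h => Finset.disjoint_left.1 ((adj_iff hk _ _).1 (h v)) h1 h2

variable [NeZero n]

theorem mem_reflectionAut (i : ℕ) (v : Vertex n k s) (c : ℤ) :
    pt n c ∈ (reflectionAut n k s i v).1.1 ↔ pt n (i - 1 - c) ∈ v.1.1 := by
  have h : pt n c = (finRotate n ^ i * (Fin.revPerm : Equiv.Perm (Fin n))) (pt n (i - 1 - c)) := by
    rw [Equiv.Perm.mul_apply, Fin.revPerm_apply, rev_pt, finRotate_pow_pt]; congr 1; ring
  change pt n c ∈ v.1.1.map (finRotate n ^ i * Fin.revPerm).toEmbedding ↔ _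
  conv_lhs => rw [h]
  exact Finset.mem_map' (finRotate n ^ i * Fin.revPerm).toEmbedding

/-- Two points at distance `d` lie on a common vertex as soon as the two arcs between them have
room for `k` gaps of length `s`. -/
theorem exists_vertex_pair (hk : 2 ≤ k) (hs : 1 ≤ s) {d : ℤ} {p q : ℕ} (hp : 1 ≤ p)
    (hq : 1 ≤ q) (h1 : (p : ℤ) * s ≤ d) (h2 : d + q * s ≤ n) (hpq : k ≤ p + q) (a : ℤ) :
    ∃ v : Vertex n k s, pt n a ∈ v.1.1 ∧ pt n (a + d) ∈ v.1.1 := by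
  -- `m` of the points lie on the arc from `a` up to `a + d`, the others from `a + d` onwards.
  obtain ⟨m, hm1, hmp, hmk, hmq⟩ : ∃ m, 1 ≤ m ∧ m ≤ p ∧ m < k ∧ k ≤ m + q := by
    rcases Nat.lt_or_ge p k with h | h
    · exact ⟨p, hp, le_rfl, h, hpq⟩
    · exact ⟨k - 1, by omega, by omega, by omega, by omega⟩
  have e : ∀ {i j : ℕ}, i ≤ j → (i : ℤ) * s ≤ j * s := fun h =>
    mul_le_mul_of_nonneg_right (by omega) (by omega)
  have hadm : Adm n k s fun i => if i < m then a + i * s else a + d + ((i - m : ℕ) : ℤ) * s := by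
    intro i j hij hj
    have e0 := e hmp
    have e3 : (0 : ℤ) ≤ i * s := by positivity
    have e4 : (0 : ℤ) ≤ ((i - m : ℕ) : ℤ) * s := by positivity
    have e5 : (0 : ℤ) ≤ d := le_trans (by positivity) h1
    by_cases hi : i < m <;> by_cases hj' : j < m <;> simp only [hi, hj', if_true, if_false]
    · have e1 := e (show i + 1 ≤ j by omega)
      have e2 := e (show j + 1 ≤ m by omega)
      have e6 : (0 : ℤ) ≤ q * s := by positivity
      push_cast at e1 e2
      rw [add_mul, one_mul] at e1 e2
      omega
    · have e1 := e (show i + 1 ≤ m by omega)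
      have e2 := e (show (j - m) + 1 ≤ q by omega)
      have e6 : (0 : ℤ) ≤ ((j - m : ℕ) : ℤ) * s := by positivity
      rw [Nat.cast_succ, add_mul, one_mul] at e1 e2
      omega
    · omega
    · have e1 := e (show (i - m) + 1 ≤ j - m by omega)
      have e2 := e (show (j - m) + 1 ≤ q by omega)
      rw [Nat.cast_succ, add_mul, one_mul] at e1 e2
      omega
  refine ⟨ofSeq hs _ hadm, mem_ofSeq.2 ⟨0, by omega, ?_⟩, mem_ofSeq.2 ⟨m, hmk, ?_⟩⟩
  · simp [show 0 < m by omega]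
  · simp

/-- A reflection interchanges two points at distance `s` or `s + 1`, according to its parity, and
these lie on a common vertex. -/
theorem not_isShift_reflectionAut (hk : 2 ≤ k) (hs : 1 ≤ s) (hn : k * s + 1 ≤ n) (i : ℕ) :
    ¬ IsShift (reflectionAut n k s i) := by
  obtain ⟨d, x, hd1, hd2, hx⟩ : ∃ d x : ℤ, (s : ℤ) ≤ d ∧ d ≤ s + 1 ∧ 2 * x + d = i - 1 := by
    rcases Int.emod_two_eq_zero_or_one ((i : ℤ) - 1 - s) with h | h
    · exact ⟨s, ((i : ℤ) - 1 - s) / 2, by omega, by omega, by omega⟩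
    · exact ⟨s + 1, ((i : ℤ) - 1 - s - 1) / 2, by omega, by omega, by omega⟩
  obtain ⟨m, rfl⟩ : ∃ m, k = m + 1 := ⟨k - 1, by omega⟩
  have hn' : ((m : ℤ) + 1) * s + 1 ≤ n := by exact_mod_cast hn
  rw [add_mul, one_mul] at hn'
  obtain ⟨v, h1, h2⟩ := exists_vertex_pair (n := n) hk hs (p := 1) (q := m) (d := d) le_rfl
    (by omega) (by simpa using hd1) (by omega) (by omega) x
  refine not_isShift_of_mem (by omega) h1 ((mem_reflectionAut _ _ _).2 ?_)
  rwa [← hx, show 2 * x + d - x = x + d by ring]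

theorem rotationAut_congr {i j : ℕ} (h : pt n i = pt n j) :
    rotationAut n k s i = rotationAut n k s j := by
  ext v : 1
  apply Vertex.ext
  ext z
  obtain ⟨c, -, -, rfl⟩ := exists_pt 0 z
  rw [mem_rotationAut, mem_rotationAut, pt_sub_congr h]

theorem isShift_rotationAut (hk : 1 ≤ k) (hns : s ≤ n) {i : ℕ}
    (hi : i ∈ Set.Icc 1 (s - 1) ∪ Set.Icc (n - s + 1) (n - 1)) :
    IsShift (rotationAut n k s i) := by
  intro v
  rw [adj_iff hk]
  apply disjoint_of_pt
  intro c hc hc'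
  rw [mem_rotationAut] at hc'
  simp only [Set.mem_union, Set.mem_Icc] at hi
  rcases hi with hi | hi
  · exact Vertex.not_close hns v hc' hc (by omega) (by omega)
  · rw [← pt_add_n (c - i)] at hc'
    exact Vertex.not_close hns v hc hc' (by omega) (by omega)

theorem mem_of_isShift_rotationAut (hk : 2 ≤ k) (hs : 2 ≤ s) (hn : (k + 1) * s - 1 ≤ n) {i : ℕ}
    (hin : i < n) (h : IsShift (rotationAut n k s i)) :
    i ∈ Set.Icc 1 (s - 1) ∪ Set.Icc (n - s + 1) (n - 1) := by
  have hn1 : (k + 1) * s ≤ n + 1 := by omega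
  have hks : 2 * s ≤ k * s := Nat.mul_le_mul_right s hk
  have hadd : (k + 1) * s = k * s + s := by ring
  by_contra hi
  simp only [Set.mem_union, Set.mem_Icc, not_or, not_and] at hi
  obtain ⟨v, h1, h2⟩ : ∃ v : Vertex n k s, pt n 0 ∈ v.1.1 ∧ pt n (0 + i) ∈ v.1.1 := by
    rcases Nat.eq_zero_or_pos i with rfl | hi0
    · obtain ⟨v, h1, -⟩ := exists_vertex_pair (n := n) (k := k) (s := s) (d := s) (p := 1)
        (q := k - 1) hk (by omega) le_rfl (by omega) (by simp)
        (by push_cast [show 1 ≤ k by omega]; rw [sub_mul, one_mul]; zify at hn1 hks hadd; omega)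
        (by omega) 0
      exact ⟨v, h1, by simpa using h1⟩
    · have hs0 : 0 < s := by omega
      have hle : s ≤ i := by omega
      have hle' : s ≤ n - i := by omega
      have hp := Nat.div_mul_le_self i s
      have hq := Nat.div_mul_le_self (n - i) s
      have hp' := Nat.lt_div_mul_add hs0 (a := i)
      have hq' := Nat.lt_div_mul_add hs0 (a := n - i)
      refine exists_vertex_pair (p := i / s) (q := (n - i) / s) hk (by omega)
        ((Nat.one_le_div_iff hs0).2 hle) ((Nat.one_le_div_iff hs0).2 hle') (by exact_mod_cast hp)
        (by have : (((n - i) / s * s : ℕ) : ℤ) ≤ n - i := by omega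
            rw [Nat.cast_mul] at this; omega) ?_ 0
      -- Rounding down the two arcs to multiples of `s` loses at most `2 (s - 1)` altogether.
      by_contra hlt
      push Not at hlt
      have := Nat.mul_le_mul_right s (show i / s + (n - i) / s + 1 ≤ k by omega)
      rw [add_mul, add_mul, one_mul] at this
      omega
  refine not_isShift_of_mem (by omega) h2 ((mem_rotationAut _ _ _).2 ?_) h
  simpa using h1

/-- Distinct rotations act differently: a nontrivial rotation does not fix the vertex
`{0, s, …, (k - 1) s}`, whose only point not preceded by another one at distance `s` is `0`. -/
theorem rotationAut_injOn (hk : 2 ≤ k) (hs : 1 ≤ s) (hn : k * s + 1 ≤ n) :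
    Set.InjOn (rotationAut n k s) (Set.Iio n) := by
  have hn' : (k : ℤ) * s + 1 ≤ n := by exact_mod_cast hn
  have key : ∀ {i j : ℕ}, i < j → j < n → rotationAut n k s i ≠ rotationAut n k s j := by
    intro i j hij hj e
    have ht : Adm n k s (tightSeq s 0 0) := tightSeq_adm le_rfl (by omega)
    have ts : ∀ i : ℕ, tightSeq s 0 0 i = i * s := by
      intro i
      by_cases h : i = 0 <;> simp [tightSeq, h]
    set v := ofSeq hs _ ht with hv
    have hmem : ∀ c : ℤ, pt n c ∈ v.1.1 ↔ pt n (c - (j - i)) ∈ v.1.1 := by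
      intro c
      have h := mem_rotationAut (n := n) i v (c + i)
      rw [e, mem_rotationAut] at h
      rw [show c - ((j : ℤ) - i) = c + i - j by ring, h, add_sub_cancel_right]
    have pred : ∀ c : ℤ, pt n c ∈ v.1.1 → pt n c ≠ pt n 0 → pt n (c - s) ∈ v.1.1 := by
      intro c hc hc0
      obtain ⟨l, hl, e⟩ := mem_ofSeq.1 hc
      rw [ts] at e
      rcases Nat.eq_zero_or_pos l with rfl | hl0
      · exact absurd (by simpa using e.symm) hc0
      · refine mem_ofSeq.2 ⟨l - 1, by omega, ?_⟩
        have := pt_add_congr e (-s)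
        rw [ts]
        push_cast [show 1 ≤ l by omega]
        rw [sub_mul, one_mul]
        exact this
    have h0 : pt n 0 ∈ v.1.1 := mem_ofSeq.2 ⟨0, by omega, by rw [ts]; simp⟩
    have h1 : pt n ((j : ℤ) - i) ∈ v.1.1 := (hmem _).2 (by simpa using h0)
    have h2 := pred _ h1 fun e => by have := pt_injOn e (by omega) (by omega); omega
    rw [hmem, show (j : ℤ) - i - s - (j - i) = -s by ring] at h2
    obtain ⟨l, hl, e⟩ := mem_ofSeq.1 h2
    rw [ts, ← pt_add_n (-(s : ℤ))] at e
    have hls : ((l : ℤ) + 1) * s ≤ k * s := mul_le_mul_of_nonneg_right (by omega) (by omega)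
    have hl0 : (0 : ℤ) ≤ l * s := by positivity
    rw [add_mul, one_mul] at hls
    have := pt_injOn e (by omega) (by omega)
    omega
  intro i hi j hj e
  rcases lt_trichotomy i j with h | h | h
  · exact absurd e (key h hj)
  · exact h
  · exact absurd e.symm (key h hi)

/-- With at least two steps of room, every automorphism is a rotation or a reflection: since all
moves over distances less than `s` occur, its point permutation preserves proximity. -/
theorem eq_rotationAut_or_reflectionAut (hk : 2 ≤ k) (hs : 2 ≤ s) (hn : (k + 1) * s - 1 ≤ n)
    (hn2 : k * s + 2 ≤ n) (φ : stableKneserGraph n k s ≃g stableKneserGraph n k s) :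
    ∃ i : ℕ, φ = rotationAut n k s i ∨ φ = reflectionAut n k s i := by
  have hn1 : (k + 1) * s ≤ n + 1 := by omega
  have hks : 2 * s ≤ k * s := Nat.mul_le_mul_right s hk
  have hadd : (k + 1) * s = k * s + s := by ring
  have hks' : (k : ℤ) * s = ((k * s : ℕ) : ℤ) := by push_cast; rfl
  obtain ⟨π, h1, h2⟩ := exists_pointPerm hk hs hn2 φ
  have near : ∀ {ψ : stableKneserGraph n k s ≃g stableKneserGraph n k s} {ρ : Equiv.Perm (Fin n)},
      (∀ v u x y, MoveAt v u x y → MoveAt (ψ v) (ψ u) (ρ x) (ρ y)) →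
      ∀ x y, Far s (ρ x) (ρ y) → Far s x y := by
    intro ψ ρ h x y
    contrapose
    intro hxy
    by_cases hne : x = y
    · subst hne
      obtain ⟨a, -, -, e⟩ := exists_pt 0 (ρ x)
      rw [← e, far_pt le_rfl (by omega)]
      omega
    · obtain ⟨a, -, -, rfl⟩ := exists_pt 0 x
      obtain ⟨c, hc1, hc2, rfl⟩ := not_far_coords hxy
      have hca : c ≠ a := fun e => hne (by rw [e])
      rcases lt_or_gt_of_ne hca with hlt | hlt
      · obtain ⟨v, u, hm⟩ := exists_moveAt (n := n) hk hs (d := a - c) (by omega) (by omega)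
          (by omega) c
        rw [add_sub_cancel] at hm
        exact fun hf => (h _ _ _ _ hm).2.2.1 hf.symm
      · obtain ⟨v, u, hm⟩ := exists_moveAt (n := n) hk hs (d := c - a) (by omega) (by omega)
          (by omega) a
        rw [add_sub_cancel] at hm
        exact (h _ _ _ _ hm).2.2.1
  have hfar : ∀ x y, Far s (π x) (π y) ↔ Far s x y := by
    intro x y
    refine ⟨near h1 x y, fun h => near (ρ := π.symm) h2 _ _ ?_⟩
    rwa [π.symm_apply_apply, π.symm_apply_apply]
  have hsub : ∀ v : Vertex n k s, ∀ x, x ∈ v.1.1 → π x ∈ (φ v).1.1 := fun v x hx =>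
    mem_of_pointPerm hk hs (by omega) h1 v hx
  obtain ⟨b, hb | hb⟩ := perm_dihedral hs (by omega) (by omega) π hfar
  · obtain ⟨i, hi0, -, hi⟩ : ∃ i : ℤ, 0 ≤ i ∧ i < 0 + n ∧ pt n i = pt n b := exists_pt 0 _
    lift i to ℕ using hi0
    refine ⟨i, Or.inl ?_⟩
    ext v : 1
    refine (Vertex.eq_of_subset fun z hz => ?_).symm
    obtain ⟨c, -, -, rfl⟩ := exists_pt 0 z
    rw [mem_rotationAut] at hz
    have := hsub v _ hz
    rwa [hb, pt_add_congr hi.symm, add_sub_cancel] at this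
  · obtain ⟨i, hi0, -, hi⟩ : ∃ i : ℤ, 0 ≤ i ∧ i < 0 + n ∧ pt n i = pt n (b + 1) := exists_pt 0 _
    lift i to ℕ using hi0
    refine ⟨i, Or.inr ?_⟩
    ext v : 1
    refine (Vertex.eq_of_subset fun z hz => ?_).symm
    obtain ⟨c, -, -, rfl⟩ := exists_pt 0 z
    rw [mem_reflectionAut] at hz
    have := hsub v _ hz
    have e := pt_add_congr hi (-1 - (i - 1 - c))
    rw [hb, show b - (i - 1 - c) = b + 1 + (-1 - (i - 1 - c)) by ring, ← e,
      show (i : ℤ) + (-1 - (i - 1 - c)) = c by ring] at this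
    exact this

end RotationsReflections

/-! ### The odd cycle -/

section OddCycle

variable {n k s : ℕ} [NeZero n]

theorem rotateV_rotateV (d e : ℤ) (v : Vertex n k s) :
    rotateV d (rotateV e v) = rotateV (d + e) v := by
  apply Vertex.ext
  ext z
  obtain ⟨c, -, -, rfl⟩ := exists_pt 0 z
  rw [mem_rotateV, mem_rotateV, mem_rotateV, sub_sub]

theorem rotateV_congr {d e : ℤ} (h : pt n d = pt n e) (v : Vertex n k s) :
    rotateV d v = rotateV e v := by
  apply Vertex.ext
  ext z
  obtain ⟨c, -, -, rfl⟩ := exists_pt 0 z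
  rw [mem_rotateV, mem_rotateV, pt_sub_congr h]

@[simp] theorem rotateV_zero (v : Vertex n k s) : rotateV 0 v = v := by
  apply Vertex.ext
  ext z
  obtain ⟨c, -, -, rfl⟩ := exists_pt 0 z
  rw [mem_rotateV, sub_zero]

theorem rotateV_eq_iff {d e : ℤ} {v w : Vertex n k s} :
    rotateV d v = rotateV e w ↔ rotateV (d - e) v = w := by
  constructor
  · intro h
    have := congrArg (rotateV (-e)) h
    rw [rotateV_rotateV, rotateV_rotateV, neg_add_cancel, rotateV_zero] at this
    rw [← this]; congr 1; ring
  · rintro rfl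
    rw [rotateV_rotateV]; congr 1; ring

/-- For `n = 2k + 1` a 2-stable set leaves exactly one pair of consecutive points uncovered, so
its only neighbours are its two rotations by one step. -/
theorem eq_rotateV_of_disjoint (hn : n = 2 * k + 1) (hk : 1 ≤ k) {v w : Vertex n k 2}
    (h : Disjoint w.1.1 v.1.1) : w = rotateV 1 v ∨ w = rotateV (-1) v := by
  have hd := rotateV_disjoint (by omega) v (e := 1) le_rfl (by norm_num)
  have hcard : (v.1.1 ∪ (rotateV 1 v).1.1)ᶜ.card = 1 := by
    rw [Finset.card_compl, Finset.card_union_of_disjoint hd.symm, v.1.2, (rotateV 1 v).1.2,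
      Fintype.card_fin]
    omega
  obtain ⟨p, hp⟩ := Finset.card_eq_one.1 hcard
  have huniq : ∀ z, z ∉ v.1.1 → z ∉ (rotateV 1 v).1.1 → z = p := by
    intro z h1 h2
    have : z ∈ (v.1.1 ∪ (rotateV 1 v).1.1)ᶜ := by simp [h1, h2]
    rw [hp] at this
    simpa using this
  obtain ⟨a, -, -, rfl⟩ := exists_pt 0 p
  have hwv : ∀ z ∈ w.1.1, z ∉ v.1.1 := fun z h1 h2 => Finset.disjoint_left.1 h h1 h2
  by_cases ha : pt n a ∈ w.1.1
  · right
    apply Vertex.eq_of_subset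
    intro z hz
    obtain ⟨c, -, -, rfl⟩ := exists_pt 0 z
    rw [mem_rotateV, sub_neg_eq_add]
    by_contra hc
    have e := huniq (pt n (c + 1)) hc (by
      rw [mem_rotateV, add_sub_cancel_right]; exact hwv _ hz)
    have e' := pt_add_congr e (-1)
    rw [add_neg_cancel_right] at e'
    rw [e'] at hz
    exact w.not_close (by omega) hz ha (by omega) (by omega)
  · left
    apply Vertex.eq_of_subset
    intro z hz
    by_contra hc
    exact ha (huniq z (hwv z hz) hc ▸ hz)

/-- As `n` is odd, no vertex is fixed by the rotation by four steps. -/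
theorem rotateV_four_ne (hn : n = 2 * k + 1) (hk : 1 ≤ k) (v : Vertex n k 2) :
    rotateV 4 v ≠ v := by
  intro h
  have hm : ∀ m : ℕ, rotateV (4 * m) v = v := by
    intro m
    induction m with
    | zero => simp
    | succ m ih =>
      push_cast
      rw [show 4 * ((m : ℤ) + 1) = 4 + 4 * m by ring, ← rotateV_rotateV, ih, h]
  have h1 : ∀ e : ℤ, e = 1 ∨ e = -1 → rotateV e v ≠ v := by
    intro e he heq
    obtain ⟨x, hx⟩ : v.1.1.Nonempty := Finset.card_pos.1 (by rw [v.1.2]; omega)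
    have hd : Disjoint (rotateV e v).1.1 v.1.1 := by
      rcases he with rfl | rfl
      · exact rotateV_disjoint (by omega) v le_rfl (by norm_num)
      · exact rotateV_neg_disjoint (by omega) v le_rfl (by norm_num)
    rw [heq] at hd
    exact Finset.disjoint_left.1 hd hx hx
  rcases Nat.even_or_odd' k with ⟨m, hkm | hkm⟩
  · refine h1 (-1) (Or.inr rfl) ?_
    rw [← rotateV_congr (pt_add_n (-1)), ← hm m]
    rw [rotateV_rotateV]
    have : (-1 : ℤ) + n + 4 * m = 4 * ((m + m : ℕ) : ℤ) := by rw [hn]; push_cast; omega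
    rw [this, hm, hm]
  · refine h1 1 (Or.inl rfl) ?_
    rw [← rotateV_congr (pt_add_n 1)]
    have : (1 : ℤ) + n = 4 * ((m + 1 : ℕ) : ℤ) := by rw [hn]; push_cast; omega
    rw [this, hm]

theorem rotateV_two_ne (hn : n = 2 * k + 1) (hk : 1 ≤ k) (v : Vertex n k 2) :
    rotateV 2 v ≠ v := by
  intro h
  apply rotateV_four_ne hn hk v
  rw [show (4 : ℤ) = 2 + 2 by norm_num, ← rotateV_rotateV, h, h]

/-- For `n = 2k + 1` all vertices are rotations of one another: a unit move is the rotation by two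
steps. -/
theorem exists_eq_rotateV (hn : n = 2 * k + 1) (hk : 1 ≤ k) :
    ∃ v0 : Vertex n k 2, ∀ v, ∃ j : ℤ, v = rotateV j v0 := by
  have hs1 : 1 ≤ 2 := by norm_num
  have ht : Adm n k 2 (tightSeq 2 0 0) := tightSeq_adm le_rfl (by omega)
  refine ⟨ofSeq hs1 _ ht, fun v => ?_⟩
  obtain ⟨x, hx⟩ : v.1.1.Nonempty := Finset.card_pos.1 (by rw [v.1.2]; omega)
  obtain ⟨a, -, -, rfl⟩ := exists_pt 0 x
  obtain ⟨f, hf, hf0, rfl⟩ := exists_ofSeq hs1 v hx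
  refine Adm.descend (n := n) (k := k) (s := 2) (a := a) (b := a + 2) le_rfl
    (fun f => ∀ hf : Adm n k 2 f, ∃ j : ℤ, ofSeq hs1 f hf = rotateV j (ofSeq hs1 _ ht))
    ?_ ?_ f hf hf0 ?_ hf
  · intro f _ hf0 hft hf
    refine ⟨a, Vertex.eq_of_subset fun z hz => ?_⟩
    obtain ⟨i, hi, rfl⟩ := mem_ofSeq.1 hz
    rw [mem_rotateV]
    refine mem_ofSeq.2 ⟨i, hi, ?_⟩
    congr 1
    by_cases h : i = 0
    · subst h; simp [tightSeq, hf0]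
    · rw [hft i (by omega) hi]; simp [tightSeq, h]; ring
  · intro f i _ hf0 hi0 hik hu hb ih hf
    obtain ⟨j, hj⟩ := ih hu
    have h := moveAt_ofSeq hs1 (by omega) (i := i) hu hf hik
      (fun j _ hj => by rw [Function.update_of_ne hj]) (by simp) (by simp; omega)
    rw [Function.update_self] at h
    have hd : Disjoint (rotateV 1 (ofSeq hs1 f hf)).1.1 (ofSeq hs1 _ hu).1.1 := by
      apply disjoint_of_pt
      intro c hc hc'
      rcases (h.symm.mem_iff _).1 hc' with e | ⟨-, hcf⟩
      · rw [mem_rotateV, sub_eq_add_neg, pt_add_congr e (-1)] at hc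
        rcases (h.mem_iff _).1 hc with e' | ⟨-, hc⟩
        · have := pt_injOn e' (by omega) (by omega); omega
        · exact Vertex.not_close (by omega) _ hc h.1 (by omega) (by omega)
      · exact Finset.disjoint_left.1
          (rotateV_disjoint (by omega) _ (e := 1) le_rfl (by norm_num)) hc hcf
    rcases eq_rotateV_of_disjoint hn hk hd with e | e
    · rw [rotateV_eq_iff] at e
      simp only [sub_self, rotateV_zero] at e
      exact absurd e.symm h.ne
    · refine ⟨-2 + j, ?_⟩
      rw [← rotateV_rotateV, ← hj]
      have := congrArg (rotateV (-1)) e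
      rw [rotateV_rotateV, rotateV_rotateV, neg_add_cancel, rotateV_zero] at this
      rw [this]; norm_num
  · intro i hi0 hik
    have := hf 0 i hi0 hik
    push_cast at this
    omega

/-- On the odd cycle a shift moves every vertex to a neighbour; two consecutive vertices cannot be
moved in different directions, so the shift is a rotation by one step. -/
theorem exists_rotation_of_odd (hn : n = 2 * k + 1) (hk : 1 ≤ k)
    {φ : stableKneserGraph n k 2 ≃g stableKneserGraph n k 2} (hφ : IsShift φ) :
    ∃ e : ℤ, ∀ v, φ v = rotateV e v := by
  have adj : ∀ v u : Vertex n k 2, Disjoint v.1.1 u.1.1 → Disjoint (φ v).1.1 (φ u).1.1 := by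
    intro v u h
    rw [← adj_iff hk] at h ⊢
    exact φ.map_adj_iff.2 h
  have two : ∀ v, φ v = rotateV 1 v ∨ φ v = rotateV (-1) v := fun v =>
    eq_rotateV_of_disjoint hn hk ((adj_iff hk _ _).1 (hφ v)).symm
  have h1d : ∀ v : Vertex n k 2, Disjoint (rotateV 1 v).1.1 v.1.1 := fun v =>
    rotateV_disjoint (by omega) v le_rfl (by norm_num)
  have step : ∀ e : ℤ, (e = 1 ∨ e = -1) → ∀ v, φ v = rotateV e v →
      φ (rotateV 1 v) = rotateV e (rotateV 1 v) := by
    rintro e (rfl | rfl) v hv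
    · rcases two (rotateV 1 v) with h | h
      · exact h
      · exfalso
        rw [rotateV_rotateV, neg_add_cancel, rotateV_zero] at h
        have ha := adj _ _ (h1d (rotateV 1 v))
        rw [h] at ha
        rcases two (rotateV 1 (rotateV 1 v)) with h' | h'
        · rw [h', rotateV_rotateV, rotateV_rotateV] at ha
          rcases eq_rotateV_of_disjoint hn hk ha with e | e <;> rw [rotateV_eq_iff] at e <;>
            norm_num at e
          · exact rotateV_two_ne hn hk v e
          · exact rotateV_four_ne hn hk v e
        · rw [rotateV_rotateV, rotateV_rotateV] at h'
          norm_num at h'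
          rw [← hv] at h'
          exact rotateV_two_ne hn hk v (φ.injective h')
    · rcases two (rotateV 1 v) with h | h
      · exfalso
        have ha := adj _ _ (h1d v)
        rw [h, hv, rotateV_rotateV] at ha
        rcases eq_rotateV_of_disjoint hn hk ha with e | e <;>
          rw [rotateV_rotateV, rotateV_eq_iff] at e <;> norm_num at e
        · exact rotateV_two_ne hn hk v e
        · exact rotateV_four_ne hn hk v e
      · exact h
  obtain ⟨v0, h0⟩ := exists_eq_rotateV (n := n) hn hk
  obtain ⟨e, he, hv0⟩ : ∃ e : ℤ, (e = 1 ∨ e = -1) ∧ φ v0 = rotateV e v0 := by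
    rcases two v0 with h | h
    · exact ⟨1, Or.inl rfl, h⟩
    · exact ⟨-1, Or.inr rfl, h⟩
  refine ⟨e, fun v => ?_⟩
  have hj : ∀ j : ℕ, φ (rotateV j v0) = rotateV e (rotateV j v0) := by
    intro j
    induction j with
    | zero => simpa using hv0
    | succ j ih =>
      have := step e he _ ih
      rw [rotateV_rotateV 1] at this
      push_cast
      rwa [add_comm (j : ℤ)]
  obtain ⟨j, rfl⟩ := h0 v
  obtain ⟨i, hi0, -, hi⟩ := exists_pt 0 (pt n j)
  rw [← rotateV_congr hi]
  lift i to ℕ using hi0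
  exact hj i

end OddCycle

/-! ### Classification of the shifts -/

theorem mainTheorem2 (n k s : ℕ) (hk : 2 ≤ k) (hs : 2 ≤ s) :
    (k * s + 1 ≤ n → ∀ i : ℕ, ¬ IsShift (reflectionAut n k s i)) ∧
    ((k + 1) * s - 1 ≤ n →
      {φ : stableKneserGraph n k s ≃g stableKneserGraph n k s | IsShift φ} =
          rotationAut n k s '' (Set.Icc 1 (s - 1) ∪ Set.Icc (n - s + 1) (n - 1)) ∧
        {φ : stableKneserGraph n k s ≃g stableKneserGraph n k s | IsShift φ}.ncard =
          2 * (s - 1)) := by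
  refine ⟨fun hn i => ?_, fun hn => ?_⟩
  · have : NeZero n := ⟨by omega⟩
    exact not_isShift_reflectionAut hk (by omega) hn i
  have hks : 2 * s ≤ k * s := Nat.mul_le_mul_right s hk
  have hadd : (k + 1) * s = k * s + s := by ring
  have hn1 : k * s + 1 ≤ n := by omega
  have : NeZero n := ⟨by omega⟩
  have hrot : ∀ φ : stableKneserGraph n k s ≃g stableKneserGraph n k s, IsShift φ →
      ∃ i : ℕ, φ = rotationAut n k s i := by
    intro φ hφ
    by_cases hn2 : k * s + 2 ≤ n
    · obtain ⟨i, h | h⟩ := eq_rotationAut_or_reflectionAut hk hs hn hn2 φ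
      · exact ⟨i, h⟩
      · exact absurd (h ▸ hφ) (not_isShift_reflectionAut hk (by omega) hn1 i)
    · obtain rfl : s = 2 := by omega
      obtain ⟨e, he⟩ := exists_rotation_of_odd (by omega) (by omega) hφ
      exact ⟨(e % (n : ℤ)).toNat, by ext v : 1; exact he v⟩
  have himg : {φ : stableKneserGraph n k s ≃g stableKneserGraph n k s | IsShift φ} =
      rotationAut n k s '' (Set.Icc 1 (s - 1) ∪ Set.Icc (n - s + 1) (n - 1)) := by
    ext φ
    constructor
    · intro hφ
      obtain ⟨i, rfl⟩ := hrot φ hφ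
      obtain ⟨j, hj0, hjn, hj⟩ := exists_pt 0 (pt n (i : ℤ))
      lift j to ℕ using hj0
      rw [← rotationAut_congr hj] at hφ ⊢
      exact ⟨j, mem_of_isShift_rotationAut hk hs hn (by omega) hφ, rfl⟩
    · rintro ⟨i, hi, rfl⟩
      exact isShift_rotationAut (by omega) (by omega) hi
  refine ⟨himg, ?_⟩
  rw [himg, Set.InjOn.ncard_image, Set.ncard_union_eq]
  · rw [← Finset.coe_Icc, ← Finset.coe_Icc, Set.ncard_coe_finset, Set.ncard_coe_finset,
      Nat.card_Icc, Nat.card_Icc]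
    omega
  · rw [Set.disjoint_left]
    intro i hi hi'
    simp only [Set.mem_Icc] at hi hi'
    omega
  · refine (rotationAut_injOn hk (by omega) hn1).mono fun i hi => ?_
    simp only [Set.mem_union, Set.mem_Icc, Set.mem_Iio] at hi ⊢
    omega
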